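/- **Setting.** Let $A$ be a selfadjoint, possibly unbounded, operator in a complex Hilbert space $\mathcal H$, with spectrum $\Sigma(A)\subset\mathbb R$ and resolvent $R(z)=(z-A)^{-1}$. Let $\Lambda\ne\emptyset$ be a finite set of eigenvalues of $A$ of finite multiplicity, let $E$ be the span of all eigenvectors of $A$ with eigenvalue in $\Lambda$, and let $m=\dim E$. Let $w_0,\dots,w_N,z_0,\dots,z_{N-1}\in\mathbb C$ and $r_N(\xi)=w_N+\sum_{k=0}^{N-1}w_k(z_k-\xi)^{-1}$. **Assumption 1 (filter).** There are $y\in\mathbb R$, $\delta>0$, $\gamma>0$ such that, with $I=\{x\in\mathbb R:|x-y|\le\gamma\}$ and $O=\{x\in\mathbb R:|x-y|\ge(1+\delta)\gamma\}$, one has $\Lambda\subset I$, $\Sigma(A)\setminus\Lambda\subset O$, $z_k\notin\overline{\Sigma(A)}$ for all $k$, and $\hat\kappa=\sup_{O}|r_N|\,/\inf_{I}|r_N|<1$ (in particular $\inf_I|r_N|>0$). **Assumption 2 (subspace).** $\mathcal V\subseteq\mathcal H$ is a linear subspace that is a Hilbert space under a norm of its own, with $\|u\|_{\mathcal H}\le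 C_{\mathcal V}\|u\|_{\mathcal V}$ for all $u\in\mathcal V$ and some $C_{\mathcal V}>0$; moreover $E\subseteq\mathcal V$, and $R(z)\mathcal V\subseteq\mathcal V$ for every $z$ in the resolvent set of $A$. **Assumption 3 (discretization).** A parameter $h$ runs through a set of positive real numbers. For each $h$, $\mathcal V_h$ is a finite-dimensional subspace of $\mathcal V$, and $R_h(z):\mathcal H\to\mathcal V_h$ are linear operators. The operators $R(z_k)$ and $R_h(z_k)$ are bounded in $\mathcal V$, and $\lim_{h\to0}\|R_h(z_k)-R(z_k)\|_{\mathcal V}=0$ for $k=0,\dots,N-1$. **Filters and the space $E_h$.** View $S_N=w_N+\sum_{k=0}^{N-1} w_kR(z_k)$ and $S_N^h=w_N+\sum_{k=0}^{N-1} w_kR_h(z_k)$ as bounded operators on $\mathcal V$. Let $\mu_*$ be the supremum of $|\mu|$ over $\mu\in\Sigma(S_N)\setminus r_N(\Lambda)$ (and $\mu_*=0$ if this set is empty). Fix a positively oriented simple closed rectifiable curve $\Theta\subset\mathbb C$ that lies in $\{|z|>\mu_*\}$, encloses every point of $r_N(\Lambda)$, and encloses no point of $\{|z|\le\mu_*\}$.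 When $\Theta$ lies in the resolvent set of $S_N^h$, put $$P_h=\frac1{2\pi\mathrm i}\oint_\Theta (z-S_N^h)^{-1}\,dz,\qquad E_h=\operatorname{ran}P_h .$$ For subspaces $M,L\subseteq\mathcal V$ let $$\operatorname{gap}_{\mathcal V}(M,L)=\max\Big[\sup_{u\in M,\ \|u\|_{\mathcal V}=1}\operatorname{dist}_{\mathcal V}(u,L),\ \sup_{u\in L,\ \|u\|_{\mathcal V}=1}\operatorname{dist}_{\mathcal V}(u,M)\Big].$$ **Theorem.** Suppose Assumptions 1–3 hold. Then there is an $h_0>0$ such that for every $h<h_0$ the curve $\Theta$ lies in the resolvent set of $S_N^h$ and, for every subspace $E_h^{(0)}\subseteq\mathcal V_h$ with $\dim E_h^{(0)}=\dim P_hE_h^{(0)}=m$, the iterates $E_h^{(\ell)}=S_N^hE_h^{(\ell-1)}$, $\ell=1,2,\dots$, satisfy $$\lim_{\ell\to\infty}\operatorname{gap}_{\mathcal V}\big(E_h^{(\ell)},E_h\big)=0 .$$ -/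

import Mathlib

open Set Filter Topology MeasureTheory
open scoped ENNReal NNReal

namespace FilteredSubspace

noncomputable section

section UnboundedOperators

variable {H : Type*} [NormedAddCommGroup H] [InnerProductSpace ℂ H]

/-- `R` is a bounded, everywhere defined two-sided inverse of `z - A : dom A → H`. -/
def IsResolventAt (A : H →ₗ.[ℂ] H) (z : ℂ) (R : H →L[ℂ] H) : Prop :=
  (∀ x : H, ∃ hx : R x ∈ A.domain, z • R x - A ⟨R x, hx⟩ = x) ∧
    ∀ u : A.domain, R (z • (u : H) - A u) = u

/-- The resolvent set of a (possibly unbounded) operator. -/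
def opResolventSet (A : H →ₗ.[ℂ] H) : Set ℂ := {z | ∃ R : H →L[ℂ] H, IsResolventAt A z R}

/-- The spectrum `Σ(A)` of a (possibly unbounded) operator. -/
def opSpectrum (A : H →ₗ.[ℂ] H) : Set ℂ := (opResolventSet A)ᶜ

open Classical in
/-- The resolvent `R(z) = (z - A)⁻¹` for `z` in the resolvent set (and `0` elsewhere). -/
def opResolvent (A : H →ₗ.[ℂ] H) (z : ℂ) : H →L[ℂ] H :=
  if hz : ∃ R : H →L[ℂ] H, IsResolventAt A z R then hz.choose else 0

theorem opResolvent_spec {A : H →ₗ.[ℂ] H} {z : ℂ} (hz : z ∈ opResolventSet A) :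
    IsResolventAt A z (opResolvent A z) := by
  have hz' : ∃ R : H →L[ℂ] H, IsResolventAt A z R := hz
  rw [opResolvent, dif_pos hz']
  exact hz'.choose_spec

/-- The eigenspace `ker (lam - A)`. -/
def eigSpace (A : H →ₗ.[ℂ] H) (lam : ℂ) : Submodule ℂ H where
  carrier := {x | ∃ hx : x ∈ A.domain, A ⟨x, hx⟩ = lam • x}
  zero_mem' := ⟨A.domain.zero_mem, by
    have h : (⟨0, A.domain.zero_mem⟩ : A.domain) = 0 := rfl
    rw [h, LinearPMap.map_zero, smul_zero]⟩
  add_mem' := by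
    rintro x y ⟨hx, hx'⟩ ⟨hy, hy'⟩
    refine ⟨A.domain.add_mem hx hy, ?_⟩
    have h : (⟨x + y, A.domain.add_mem hx hy⟩ : A.domain) = ⟨x, hx⟩ + ⟨y, hy⟩ := rfl
    rw [h, LinearPMap.map_add, hx', hy', smul_add]
  smul_mem' := by
    rintro c x ⟨hx, hx'⟩
    refine ⟨A.domain.smul_mem c hx, ?_⟩
    have h : (⟨c • x, A.domain.smul_mem c hx⟩ : A.domain) = c • ⟨x, hx⟩ := rfl
    rw [h, LinearPMap.map_smul, hx', smul_comm]

/-- The space `E` spanned by all eigenvectors of `A` with eigenvalue in `Λ`. -/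
def targetSpace (A : H →ₗ.[ℂ] H) (Λ : Finset ℂ) : Submodule ℂ H := ⨆ lam ∈ Λ, eigSpace A lam

end UnboundedOperators

section Filters

variable {N : ℕ}

/-- The rational function `r_N(ξ) = w_N + ∑_{k < N} w_k / (z_k - ξ)`. -/
def rN (w : Fin (N + 1) → ℂ) (z : Fin N → ℂ) (ξ : ℂ) : ℂ :=
  w (Fin.last N) + ∑ k : Fin N, w k.castSucc * (z k - ξ)⁻¹

/-- `I_γ^y`. -/
def innerInterval (y γ : ℝ) : Set ℝ := {x | |x - y| ≤ γ}

/-- `O_{δ,γ}^y`. -/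
def outerSet (y δ γ : ℝ) : Set ℝ := {x | (1 + δ) * γ ≤ |x - y|}

/-- `sup |r_N|` over a set `X` of real numbers, in `[0, ∞]`. The finitely many nodes `z_k`, where
the formula for `r_N` is meaningless, are left out; when `X` has no isolated points the value is
the supremum over `X` of the continuous extension of `|r_N|` with values in `[0, ∞]`. -/
def supAbs (w : Fin (N + 1) → ℂ) (z : Fin N → ℂ) (X : Set ℝ) : ℝ≥0∞ :=
  ⨆ x ∈ {x : ℝ | x ∈ X ∧ ∀ k, z k ≠ (x : ℂ)}, ‖rN w z (x : ℂ)‖ₑ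

/-- `inf |r_N|` over a set `X` of real numbers, with the same convention as in `supAbs`. -/
def infAbs (w : Fin (N + 1) → ℂ) (z : Fin N → ℂ) (X : Set ℝ) : ℝ≥0∞ :=
  ⨅ x ∈ {x : ℝ | x ∈ X ∧ ∀ k, z k ≠ (x : ℂ)}, ‖rN w z (x : ℂ)‖ₑ

/-- The contraction factor `κ̂ = sup_{O} |r_N| / inf_{I} |r_N|`. -/
def kappaHat (w : Fin (N + 1) → ℂ) (z : Fin N → ℂ) (y δ γ : ℝ) : ℝ≥0∞ :=
  supAbs w z (outerSet y δ γ) / infAbs w z (innerInterval y γ)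

/-- Assumption on the cluster `Λ` and on the filter: spectral separation with parameters
`y, δ, γ`, nodes off the spectrum, and `κ̂ < 1` (with a nonzero denominator, so that the
quotient is meaningful). -/
def FilterAssumption {H : Type*} [NormedAddCommGroup H] [InnerProductSpace ℂ H]
    (A : H →ₗ.[ℂ] H) (Λ : Finset ℂ) (w : Fin (N + 1) → ℂ) (z : Fin N → ℂ) : Prop :=
  ∃ y δ γ : ℝ, 0 < δ ∧ 0 < γ ∧
    (Λ : Set ℂ) ⊆ Complex.ofReal '' innerInterval y γ ∧
    opSpectrum A \ (Λ : Set ℂ) ⊆ Complex.ofReal '' outerSet y δ γ ∧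
    (∀ k, z k ∉ closure (opSpectrum A)) ∧
    infAbs w z (innerInterval y γ) ≠ 0 ∧
    kappaHat w z y δ γ < 1

end Filters

section SubspaceV

variable {H V : Type*} [NormedAddCommGroup H] [InnerProductSpace ℂ H]
  [NormedAddCommGroup V] [InnerProductSpace ℂ V]

/-- Assumption on the Hilbert space `V ⊆ H`, the inclusion being the injective map `ι`:
`‖u‖_H ≤ C_V ‖u‖_V`, `E ⊆ V`, and `V` is invariant under the resolvent of `A`. -/
structure SubspaceAssumption (A : H →ₗ.[ℂ] H) (Λ : Finset ℂ) (ι : V →ₗ[ℂ] H) : Prop where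
  injective : Function.Injective ι
  bound : ∃ C : ℝ, 0 < C ∧ ∀ u : V, ‖ι u‖ ≤ C * ‖u‖
  contains : targetSpace A Λ ≤ LinearMap.range ι
  invariant : ∀ z ∈ opResolventSet A, ∀ u : V, opResolvent A z (ι u) ∈ LinearMap.range ι

/-- The operator `T` on `H` is bounded in `V`: it maps `V` into `V`, and its restriction to `V`
is bounded for the norm of `V`. -/
def BoundedIn (ι : V →ₗ[ℂ] H) (T : H →ₗ[ℂ] H) : Prop :=
  ∃ T' : V →L[ℂ] V, ∀ u : V, ι (T' u) = T (ι u)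

open Classical in
/-- The operator `T` viewed as a bounded operator on `V` (and `0` if it is not one). -/
def onV (ι : V →ₗ[ℂ] H) (T : H →ₗ[ℂ] H) : V →L[ℂ] V :=
  if hT : BoundedIn ι T then hT.choose else 0

theorem onV_spec {ι : V →ₗ[ℂ] H} {T : H →ₗ[ℂ] H} (hT : BoundedIn ι T) (u : V) :
    ι (onV ι T u) = T (ι u) := by
  rw [onV, dif_pos hT]
  exact hT.choose_spec u

variable {N : ℕ}

/-- The filter `S_N = r_N(A) = w_N + ∑ w_k R(z_k)`, viewed as an operator on `V`. -/
def filterOp (A : H →ₗ.[ℂ] H) (ι : V →ₗ[ℂ] H) (w : Fin (N + 1) → ℂ) (z : Fin N → ℂ) :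
    V →L[ℂ] V :=
  w (Fin.last N) • ContinuousLinearMap.id ℂ V +
    ∑ k : Fin N, w k.castSucc • onV ι (opResolvent A (z k) : H →ₗ[ℂ] H)

/-- An operator `H → V_h ⊆ V` regarded as an operator on `H`. -/
def extendToH (ι : V →ₗ[ℂ] H) (Vh : Submodule ℂ V) (T : H →ₗ[ℂ] Vh) : H →ₗ[ℂ] H :=
  ι ∘ₗ Vh.subtype ∘ₗ T

/-- The discretized filter `S_N^h = w_N + ∑ w_k R_h(z_k)`, viewed as an operator on `V`. -/
def discreteFilterOp (ι : V →ₗ[ℂ] H) (w : Fin (N + 1) → ℂ) (z : Fin N → ℂ)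
    (Vh : Submodule ℂ V) (Rh : ℂ → H →ₗ[ℂ] Vh) : V →L[ℂ] V :=
  w (Fin.last N) • ContinuousLinearMap.id ℂ V +
    ∑ k : Fin N, w k.castSucc • onV ι (extendToH ι Vh (Rh (z k)))

/-- Assumption on the discretized resolvents, for a mesh parameter `h` that runs through `hs`:
`R_h(z_k)` and `R(z_k)` are bounded in `V`, and `‖R_h(z_k) - R(z_k)‖_V → 0` as `h → 0`. -/
structure ResolventLimitAssumption (A : H →ₗ.[ℂ] H) (ι : V →ₗ[ℂ] H) (z : Fin N → ℂ)
    (hs : Set ℝ) (Vh : ℝ → Submodule ℂ V) (Rh : (h : ℝ) → ℂ → H →ₗ[ℂ] Vh h) : Prop where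
  bounded : ∀ k, BoundedIn ι (opResolvent A (z k) : H →ₗ[ℂ] H)
  bounded_discrete : ∀ h ∈ hs, ∀ k, BoundedIn ι (extendToH ι (Vh h) (Rh h (z k)))
  tendsto : ∀ k, Tendsto
    (fun h : ℝ => ‖onV ι (extendToH ι (Vh h) (Rh h (z k))) -
      onV ι (opResolvent A (z k) : H →ₗ[ℂ] H)‖) (𝓝[hs] 0) (𝓝 0)

end SubspaceV

section Contours

/-- A simple closed rectifiable curve, given by a Lipschitz parametrization on `[0, 1]`. -/
structure IsSimpleClosedCurve (θ : ℝ → ℂ) : Prop where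
  rectifiable : ∃ K : ℝ≥0, LipschitzOnWith K θ (Icc 0 1)
  closed : θ 0 = θ 1
  simple : InjOn θ (Ico 0 1)

/-- The normalized contour integral `(2πi)⁻¹ ∮_θ f(z) dz`. -/
def contourIntegral {X : Type*} [NormedAddCommGroup X] [NormedSpace ℂ X]
    (θ : ℝ → ℂ) (f : ℂ → X) : X :=
  (2 * (Real.pi : ℂ) * Complex.I)⁻¹ • ∫ t in (0 : ℝ)..1, deriv θ t • f (θ t)

/-- The winding number of `θ` about `a` (a point off the curve). -/
def windingNumber (θ : ℝ → ℂ) (a : ℂ) : ℂ := contourIntegral θ (fun z => (z - a)⁻¹)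

variable {V : Type*} [NormedAddCommGroup V] [InnerProductSpace ℂ V]

/-- `μ_* = sup {|μ| : μ ∈ Σ(T) \ M}`, where the supremum of the empty set is `0`. -/
def muStar (T : V →L[ℂ] V) (M : Set ℂ) : ℝ := sSup (norm '' (spectrum ℂ T \ M))

/-- `θ` is a positively oriented simple closed rectifiable curve that encloses the set `M` of
dominant eigenvalues of `T`, lies strictly outside the circle of radius `μ_*` about `0`, and
does not enclose any point of the disc of radius `μ_*` (for a positively oriented simple closed
curve, the winding number is `1` about the enclosed points and `0` about the points outside). -/
structure IsSeparatingContour (T : V →L[ℂ] V) (M : Set ℂ) (θ : ℝ → ℂ) : Prop where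
  curve : IsSimpleClosedCurve θ
  outside : ∀ t ∈ Icc (0 : ℝ) 1, muStar T M < ‖θ t‖
  encloses : ∀ μ ∈ M, μ ∉ θ '' Icc 0 1 ∧ windingNumber θ μ = 1
  excludes : ∀ a : ℂ, ‖a‖ ≤ muStar T M → windingNumber θ a = 0

/-- `(2πi)⁻¹ ∮_θ (z - T)⁻¹ dz`. -/
def spectralProjector (T : V →L[ℂ] V) (θ : ℝ → ℂ) : V →L[ℂ] V :=
  contourIntegral θ (fun z => resolvent T z)

end Contours

section Iteration

variable {V : Type*} [NormedAddCommGroup V] [InnerProductSpace ℂ V]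

/-- `sup {dist (x, L) : x ∈ M, ‖x‖ = 1}`. -/
def oneSidedGap (M L : Submodule ℂ V) : ℝ :=
  sSup ((fun x : V => Metric.infDist x (L : Set V)) '' {x : V | x ∈ M ∧ ‖x‖ = 1})

/-- The gap between two linear subspaces. -/
def gap (M L : Submodule ℂ V) : ℝ := max (oneSidedGap M L) (oneSidedGap L M)

/-- Subspace iterates: `E^(0) = E₀` and `E^(l+1) = T E^(l)`. -/
def iterates (T : V →L[ℂ] V) (E₀ : Submodule ℂ V) : ℕ → Submodule ℂ V
  | 0 => E₀
  | l + 1 => (iterates T E₀ l).map (T : V →ₗ[ℂ] V)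

end Iteration

end

end FilteredSubspace

/-! Write T for `S_N` and B for `S_N^h` on V, P_T and P_h for their contour projectors, M for
`r_N(Λ)`. Convergence for fixed h is ordinary subspace iteration; the substance is that `E_h` has
dimension at most m for small h. On H, the resolvent R(z₀) at a node is normal, and its continuous
functional calculus gives both `r_N(A)` and a projection p onto E (`exists_cluster_projection`).
Because κ̂ < 1, no point of M remains in the spectrum of `r_N(A)(1 - p)`. As p has finite rank and E
⊆ V, it restricts to a bounded idempotent Q on V commuting with T. The spectrum in V may differ from
the one in H, so the same has to be proved again for T(1 - Q). Outside the disc of radius μ_* its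
spectrum can only meet the finite set M. A point of M would then be isolated, and its Riesz
projection vanishes since the inclusion into H is injective and intertwines the resolvents
(`mem_resolventSet_of_intertwining`). Thus T(1 - Q) has its spectrum in that disc, and P_T kills ker
Q. For small h, upper semicontinuity keeps the spectrum of B near that disc and M, and ‖P_h - P_T‖ ≤
1/2. If u = P_h u and Qu = 0, then u = (P_h - P_T)u, so u = 0: Q is injective on `E_h`, whence dim
`E_h` ≤ m. The dimension hypotheses then make P_h a bijection from the initial space onto `E_h`.
Finally B differs from a scalar by an operator of finite rank, so it satisfies a polynomial
equation. Splitting its minimal polynomial into coprime factors f (small roots) and g (roots near M)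
gives V = ker f(B) ⊕ ker g(B), on which P_h acts as 0 and 1. This needs only the winding numbers
about 0 and M (`spectralProjector_apply_eq_windingNumber_smul`). B grows faster on ker g(B) than on
ker f(B), and `tendsto_gap_iterates` concludes. -/

namespace FilteredSubspace

/-! ### Calculus along Lipschitz curves -/

section LipschitzCurves

theorem ae_differentiableAt_of_lipschitzOnWith {E : Type*} [NormedAddCommGroup E]
    [NormedSpace ℝ E] [FiniteDimensional ℝ E] {K : ℝ≥0} {φ : ℝ → E}
    (hφ : LipschitzOnWith K φ (Icc 0 1)) :
    ∀ᵐ t : ℝ, t ∈ Ioo (0 : ℝ) 1 → DifferentiableAt ℝ φ t := by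
  filter_upwards [hφ.ae_differentiableWithinAt_of_mem_real] with t ht hmem
  exact (ht (Ioo_subset_Icc_self hmem)).differentiableAt (Icc_mem_nhds hmem.1 hmem.2)

theorem norm_deriv_le_of_lipschitzOnWith {E : Type*} [NormedAddCommGroup E]
    [NormedSpace ℝ E] {K : ℝ≥0} {φ : ℝ → E}
    (hφ : LipschitzOnWith K φ (Icc 0 1)) {t : ℝ} (ht : t ∈ Ioo (0 : ℝ) 1) :
    ‖deriv φ t‖ ≤ K :=
  norm_deriv_le_of_lipschitzOn (Icc_mem_nhds ht.1 ht.2) hφ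

theorem ae_uIoc_of_forall_Ioo {p : ℝ → Prop} (h : ∀ᵐ t : ℝ, t ∈ Ioo (0 : ℝ) 1 → p t) :
    ∀ᵐ t : ℝ, t ∈ uIoc (0 : ℝ) 1 → p t := by
  have h1 : ∀ᵐ t : ℝ, t ≠ 1 := by
    simp [ae_iff, measure_singleton]
  filter_upwards [h, h1] with t ht h1 hmem
  rw [uIoc_of_le zero_le_one] at hmem
  exact ht ⟨hmem.1, lt_of_le_of_ne hmem.2 h1⟩

theorem intervalIntegrable_deriv_smul {X : Type*} [NormedAddCommGroup X] [NormedSpace ℂ X]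
    {K : ℝ≥0} {φ : ℝ → ℂ} (hφ : LipschitzOnWith K φ (Icc 0 1)) {f : ℝ → X}
    (hf : ContinuousOn f (Icc 0 1)) :
    IntervalIntegrable (fun t => deriv φ t • f t) volume 0 1 := by
  have hf' : IntervalIntegrable f volume 0 1 :=
    ContinuousOn.intervalIntegrable (by rwa [uIcc_of_le zero_le_one])
  rw [intervalIntegrable_iff] at hf' ⊢
  refine Integrable.bdd_smul hf' (K : ℝ) (measurable_deriv φ).aestronglyMeasurable ?_
  rw [ae_restrict_iff' measurableSet_uIoc]
  exact ae_uIoc_of_forall_Ioo (Eventually.of_forall fun t ht =>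
    norm_deriv_le_of_lipschitzOnWith hφ ht)

/-- Lipschitz functions are absolutely continuous; the fundamental theorem of calculus is applied to
the real and imaginary parts. -/
theorem integral_deriv_of_lipschitzOnWith {K : ℝ≥0} {φ : ℝ → ℂ}
    (hφ : LipschitzOnWith K φ (Icc 0 1)) :
    ∫ t in (0 : ℝ)..1, deriv φ t = φ 1 - φ 0 := by
  have hint : IntervalIntegrable (fun t => deriv φ t) volume 0 1 := by
    simpa using intervalIntegrable_deriv_smul hφ (f := fun _ => (1 : ℂ)) continuousOn_const
  have hre : LipschitzOnWith (1 * K) (fun t => (φ t).re) (Icc 0 1) :=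
    LipschitzWith.comp_lipschitzOnWith (f := Complex.re)
      (LipschitzWith.of_dist_le_mul fun x y => by
        simpa [Real.dist_eq, Complex.dist_eq] using Complex.abs_re_le_norm (x - y)) hφ
  have him : LipschitzOnWith (1 * K) (fun t => (φ t).im) (Icc 0 1) :=
    LipschitzWith.comp_lipschitzOnWith (f := Complex.im)
      (LipschitzWith.of_dist_le_mul fun x y => by
        simpa [Real.dist_eq, Complex.dist_eq] using Complex.abs_im_le_norm (x - y)) hφ
  rw [← uIcc_of_le (zero_le_one' ℝ)] at hre him
  have h1 := hre.absolutelyContinuousOnInterval.integral_deriv_eq_sub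
  have h2 := him.absolutelyContinuousOnInterval.integral_deriv_eq_sub
  have e1 : (∫ t in (0 : ℝ)..1, deriv φ t).re = ∫ t in (0 : ℝ)..1, (deriv φ t).re :=
    (Complex.reCLM.intervalIntegral_comp_comm hint).symm
  have e2 : (∫ t in (0 : ℝ)..1, deriv φ t).im = ∫ t in (0 : ℝ)..1, (deriv φ t).im :=
    (Complex.imCLM.intervalIntegral_comp_comm hint).symm
  have hae := ae_uIoc_of_forall_Ioo (ae_differentiableAt_of_lipschitzOnWith hφ)
  have c1 : ∫ t in (0 : ℝ)..1, (deriv φ t).re = ∫ t in (0 : ℝ)..1, deriv (fun t => (φ t).re) t := by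
    refine intervalIntegral.integral_congr_ae ?_
    filter_upwards [hae] with t ht hm
    exact ((Complex.reCLM.hasFDerivAt.comp_hasDerivAt t (ht hm).hasDerivAt).deriv).symm
  have c2 : ∫ t in (0 : ℝ)..1, (deriv φ t).im = ∫ t in (0 : ℝ)..1, deriv (fun t => (φ t).im) t := by
    refine intervalIntegral.integral_congr_ae ?_
    filter_upwards [hae] with t ht hm
    exact ((Complex.imCLM.hasFDerivAt.comp_hasDerivAt t (ht hm).hasDerivAt).deriv).symm
  apply Complex.ext
  · rw [e1, c1, h1]; simp
  · rw [e2, c2, h2]; simp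

theorem exists_pos_le_norm_sub {θ : ℝ → ℂ} (hθ : ContinuousOn θ (Icc 0 1)) {a : ℂ}
    (ha : a ∉ θ '' Icc 0 1) : ∃ d : ℝ, 0 < d ∧ ∀ t ∈ Icc (0 : ℝ) 1, d < ‖θ t - a‖ := by
  obtain ⟨t₀, ht₀, hmin⟩ := isCompact_Icc.exists_isMinOn (nonempty_Icc.2 (zero_le_one' ℝ))
    (f := fun t => ‖θ t - a‖) (by fun_prop)
  have hpos : 0 < ‖θ t₀ - a‖ := by
    rw [norm_pos_iff, sub_ne_zero]
    rintro h
    exact ha ⟨t₀, ht₀, h⟩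
  exact ⟨_, half_pos hpos, fun t ht => (half_lt_self hpos).trans_le (hmin ht)⟩

/-- The curve keeps a positive distance from `a`, where inversion and powers are Lipschitz. This
admits the powers as antiderivatives below. -/
theorem exists_lipschitzOnWith_inv_pow {K : ℝ≥0} {θ : ℝ → ℂ}
    (hθ : LipschitzOnWith K θ (Icc 0 1)) {a : ℂ} (ha : a ∉ θ '' Icc 0 1) (m : ℕ) :
    ∃ L : ℝ≥0, LipschitzOnWith L (fun t => ((θ t - a)⁻¹) ^ m) (Icc 0 1) := by
  obtain ⟨d, hd, hda⟩ := exists_pos_le_norm_sub hθ.continuousOn ha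
  have hb : ∀ t ∈ Icc (0 : ℝ) 1, ‖(θ t - a)⁻¹‖ ≤ d⁻¹ := fun t ht => by
    rw [norm_inv]
    exact inv_anti₀ hd (hda t ht).le
  have h1 : ∀ s ∈ Icc (0 : ℝ) 1, ∀ t ∈ Icc (0 : ℝ) 1,
      ‖(θ s - a)⁻¹ - (θ t - a)⁻¹‖ ≤ (d⁻¹ * d⁻¹ * K) * dist s t := by
    intro s hs t ht
    have hs0 : θ s - a ≠ 0 := norm_pos_iff.1 (hd.trans (hda s hs))
    have ht0 : θ t - a ≠ 0 := norm_pos_iff.1 (hd.trans (hda t ht))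
    have e : (θ s - a)⁻¹ - (θ t - a)⁻¹ = (θ s - a)⁻¹ * (θ t - a)⁻¹ * (θ t - θ s) := by
      field_simp
      ring
    rw [e, norm_mul, norm_mul, mul_assoc _ (K : ℝ)]
    have hl := hθ.dist_le_mul t ht s hs
    rw [dist_eq_norm, dist_comm] at hl
    have := hb s hs
    have := hb t ht
    gcongr
  have key : ∀ m : ℕ, ∃ L : ℝ≥0, ∀ s ∈ Icc (0 : ℝ) 1, ∀ t ∈ Icc (0 : ℝ) 1,
      ‖((θ s - a)⁻¹) ^ m - ((θ t - a)⁻¹) ^ m‖ ≤ L * dist s t := by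
    intro m
    induction m with
    | zero => exact ⟨0, fun s _ t _ => by simp⟩
    | succ m ih =>
      obtain ⟨L, hL⟩ := ih
      refine ⟨⟨L * d⁻¹ + (d⁻¹) ^ m * (d⁻¹ * d⁻¹ * K), by positivity⟩, fun s hs t ht => ?_⟩
      have e : ((θ s - a)⁻¹) ^ (m + 1) - ((θ t - a)⁻¹) ^ (m + 1) =
          (((θ s - a)⁻¹) ^ m - ((θ t - a)⁻¹) ^ m) * (θ s - a)⁻¹ +
            ((θ t - a)⁻¹) ^ m * ((θ s - a)⁻¹ - (θ t - a)⁻¹) := by ring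
      have hpow : ‖((θ t - a)⁻¹) ^ m‖ ≤ (d⁻¹) ^ m := by
        rw [norm_pow]
        exact pow_le_pow_left₀ (norm_nonneg _) (hb t ht) m
      calc _ ≤ ‖((θ s - a)⁻¹) ^ m - ((θ t - a)⁻¹) ^ m‖ * ‖(θ s - a)⁻¹‖ +
            ‖((θ t - a)⁻¹) ^ m‖ * ‖(θ s - a)⁻¹ - (θ t - a)⁻¹‖ := by
              rw [e, ← norm_mul, ← norm_mul]; exact norm_add_le _ _
        _ ≤ (L * dist s t) * d⁻¹ + (d⁻¹) ^ m * ((d⁻¹ * d⁻¹ * K) * dist s t) := by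
              gcongr
              · exact hL s hs t ht
              · exact hb s hs
              · exact h1 s hs t ht
        _ = (L * d⁻¹ + (d⁻¹) ^ m * (d⁻¹ * d⁻¹ * K)) * dist s t := by ring
  obtain ⟨L, hL⟩ := key m
  exact ⟨L, LipschitzOnWith.of_dist_le_mul fun s hs t ht => by
    rw [dist_eq_norm]; exact hL s hs t ht⟩

/-- The integral of `(z - a)⁻¹ ^ (m + 1)` over a closed curve off `a` vanishes for `m ≥ 1`. -/
theorem integral_deriv_mul_inv_pow_eq_zero {K : ℝ≥0} {θ : ℝ → ℂ}
    (hθ : LipschitzOnWith K θ (Icc 0 1)) (hclosed : θ 0 = θ 1) {a : ℂ}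
    (ha : a ∉ θ '' Icc 0 1) {m : ℕ} (hm : m ≠ 0) :
    ∫ t in (0 : ℝ)..1, deriv θ t * ((θ t - a)⁻¹) ^ (m + 1) = 0 := by
  -- Up to the factor -m, the integrand is the derivative of `(θ - a)⁻¹ ^ m`, which has equal values
  -- at the two ends.
  obtain ⟨L, hL⟩ := exists_lipschitzOnWith_inv_pow hθ ha m
  have h := integral_deriv_of_lipschitzOnWith hL
  simp only [hclosed, sub_self] at h
  have e : ∫ t in (0 : ℝ)..1, deriv (fun t => ((θ t - a)⁻¹) ^ m) t =
      ∫ t in (0 : ℝ)..1, (-(m : ℂ)) * (deriv θ t * ((θ t - a)⁻¹) ^ (m + 1)) := by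
    refine intervalIntegral.integral_congr_ae ?_
    filter_upwards [ae_uIoc_of_forall_Ioo (ae_differentiableAt_of_lipschitzOnWith hθ)] with t ht hmem
    have hne : θ t - a ≠ 0 := by
      rw [sub_ne_zero]
      rintro h
      exact ha ⟨t, uIcc_of_le (zero_le_one' ℝ) ▸ uIoc_subset_uIcc hmem, h⟩
    have hd := (((ht hmem).hasDerivAt.sub_const a).fun_inv hne).fun_pow m
    rw [hd.deriv]
    obtain ⟨k, rfl⟩ := Nat.exists_eq_succ_of_ne_zero hm
    simp only [Nat.succ_eq_add_one, Nat.add_sub_cancel, div_eq_mul_inv, ← inv_pow]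
    ring
  rw [e, intervalIntegral.integral_const_mul] at h
  have : (-(m : ℂ)) ≠ 0 := by simpa using hm
  exact (mul_eq_zero.1 h).resolve_left this

end LipschitzCurves

/-! ### Elementary rules for contour integrals -/

section ContourIntegrals

variable {V : Type*} [NormedAddCommGroup V] [NormedSpace ℂ V]

theorem norm_contourIntegral_le {K : ℝ≥0} {θ : ℝ → ℂ} (hθ : LipschitzOnWith K θ (Icc 0 1))
    {f : ℂ → V} {M : ℝ} (hf : ∀ t ∈ Icc (0 : ℝ) 1, ‖f (θ t)‖ ≤ M) :
    ‖contourIntegral θ f‖ ≤ K * M := by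
  have h : ‖∫ t in (0 : ℝ)..1, deriv θ t • f (θ t)‖ ≤ K * M * |1 - 0| := by
    refine intervalIntegral.norm_integral_le_of_norm_le_const_ae
      (ae_uIoc_of_forall_Ioo (Eventually.of_forall fun t ht => ?_))
    rw [norm_smul]
    have := hf t (Ioo_subset_Icc_self ht)
    have := norm_deriv_le_of_lipschitzOnWith hθ ht
    gcongr
  have hpi : ‖(2 * (Real.pi : ℂ) * Complex.I)⁻¹‖ ≤ 1 := by
    have := Real.pi_gt_three
    rw [norm_inv]
    refine inv_le_one_of_one_le₀ ?_
    simp only [norm_mul, Complex.norm_ofNat, Complex.norm_real, Complex.norm_I, Real.norm_eq_abs,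
      abs_of_pos Real.pi_pos, mul_one]
    linarith
  rw [contourIntegral, norm_smul]
  simp only [sub_zero, abs_one, mul_one] at h
  calc _ ≤ 1 * ‖∫ t in (0 : ℝ)..1, deriv θ t • f (θ t)‖ := by gcongr
    _ ≤ _ := by rwa [one_mul]

theorem contourIntegral_sub {K : ℝ≥0} {θ : ℝ → ℂ} (hθ : LipschitzOnWith K θ (Icc 0 1))
    {f g : ℂ → V} (hf : ContinuousOn (fun t => f (θ t)) (Icc 0 1))
    (hg : ContinuousOn (fun t => g (θ t)) (Icc 0 1)) :
    contourIntegral θ f - contourIntegral θ g = contourIntegral θ (fun z => f z - g z) := by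
  rw [contourIntegral, contourIntegral, contourIntegral, ← smul_sub,
    ← intervalIntegral.integral_sub (intervalIntegrable_deriv_smul hθ hf)
      (intervalIntegrable_deriv_smul hθ hg)]
  simp only [smul_sub]

theorem contourIntegral_congr {θ : ℝ → ℂ} {f g : ℂ → V}
    (h : ∀ t ∈ Icc (0 : ℝ) 1, f (θ t) = g (θ t)) : contourIntegral θ f = contourIntegral θ g := by
  rw [contourIntegral, contourIntegral]
  congr 1
  refine intervalIntegral.integral_congr fun t ht => ?_
  rw [uIcc_of_le zero_le_one] at ht
  simp only [h t ht]

theorem contourIntegral_smul_const [CompleteSpace V] {θ : ℝ → ℂ} (f : ℂ → ℂ) (u : V) :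
    contourIntegral θ (fun z => f z • u) = contourIntegral θ f • u := by
  rw [contourIntegral, contourIntegral, smul_assoc, ← intervalIntegral.integral_smul_const]
  simp only [smul_assoc]

end ContourIntegrals

/-! ### Contour integrals of the resolvent -/

section Resolvents

theorem continuousOn_resolvent_comp {B : Type*} [NormedRing B] [NormedAlgebra ℂ B]
    [CompleteSpace B] {T : B} {θ : ℝ → ℂ} (hθ : ContinuousOn θ (Icc 0 1))
    (hT : θ '' Icc 0 1 ⊆ resolventSet ℂ T) :
    ContinuousOn (fun t => resolvent T (θ t)) (Icc 0 1) := fun t ht =>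
  (spectrum.hasDerivAt_resolvent_const_left (hT ⟨t, ht, rfl⟩)).continuousAt.comp_continuousWithinAt
    (hθ t ht)

theorem sub_mul_resolvent {B : Type*} [Ring B] [Algebra ℂ B] {T : B} {z : ℂ}
    (hz : z ∈ resolventSet ℂ T) : (algebraMap ℂ B z - T) * resolvent T z = 1 :=
  Ring.mul_inverse_cancel _ hz

theorem resolvent_mul_sub {B : Type*} [Ring B] [Algebra ℂ B] {T : B} {z : ℂ}
    (hz : z ∈ resolventSet ℂ T) : resolvent T z * (algebraMap ℂ B z - T) = 1 :=
  Ring.inverse_mul_cancel _ hz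

variable {V : Type*} [NormedAddCommGroup V] [InnerProductSpace ℂ V] [CompleteSpace V]

theorem spectralProjector_apply {K : ℝ≥0} {θ : ℝ → ℂ} (hθ : LipschitzOnWith K θ (Icc 0 1))
    {T : V →L[ℂ] V} (hT : θ '' Icc 0 1 ⊆ resolventSet ℂ T) (u : V) :
    spectralProjector T θ u = contourIntegral θ (fun z => resolvent T z u) := by
  rw [spectralProjector, contourIntegral, contourIntegral, smul_apply,
    ContinuousLinearMap.intervalIntegral_apply (intervalIntegrable_deriv_smul hθ
      (continuousOn_resolvent_comp hθ.continuousOn hT))]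
  rfl

/-- On a vector `u` with `‖(T - a)ⁿ u‖ ≤ C ρⁿ`, where `ρ` is smaller than the distance from `a` to
the contour, the spectral projector acts as multiplication by the winding number about `a`. -/
theorem spectralProjector_apply_eq_windingNumber_smul {K : ℝ≥0} {θ : ℝ → ℂ}
    (hθ : LipschitzOnWith K θ (Icc 0 1)) (hclosed : θ 0 = θ 1)
    {T : V →L[ℂ] V} (hT : θ '' Icc 0 1 ⊆ resolventSet ℂ T) {a : ℂ} {ρ d C : ℝ} (hρ : 0 ≤ ρ)
    (hρd : ρ < d) (hd : ∀ t ∈ Icc (0 : ℝ) 1, d ≤ ‖θ t - a‖) {u : V}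
    (hu : ∀ n : ℕ, ‖((T - algebraMap ℂ _ a) ^ n) u‖ ≤ C * ρ ^ n) :
    spectralProjector T θ u = windingNumber θ a • u := by
  have hd0 : 0 < d := hρ.trans_lt hρd
  have hne : ∀ t ∈ Icc (0 : ℝ) 1, θ t - a ≠ 0 := fun t ht =>
    norm_pos_iff.1 (hd0.trans_le (hd t ht))
  have ha : a ∉ θ '' Icc 0 1 := by
    rintro ⟨t, ht, h⟩
    exact hne t ht (sub_eq_zero.2 h)
  have hcr := continuousOn_resolvent_comp hθ.continuousOn hT
  have hci : ContinuousOn (fun t => (θ t - a)⁻¹) (Icc 0 1) :=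
    (hθ.continuousOn.sub continuousOn_const).inv₀ hne
  set D := T - algebraMap ℂ (V →L[ℂ] V) a with hD
  -- `J m` integrates the remainder after m terms of the expansion of R(z)u in powers of (z - a)⁻¹,
  -- namely (z - a)⁻ᵐ R(z)(T - a)ᵐu.
  set J : ℕ → V := fun m =>
    contourIntegral θ (fun z => ((z - a)⁻¹) ^ m • resolvent T z ((D ^ m) u)) with hJ
  have hcJ : ∀ m, ContinuousOn (fun t => ((θ t - a)⁻¹) ^ m • resolvent T (θ t) ((D ^ m) u))
      (Icc 0 1) := fun m => (hci.pow m).smul (hcr.clm_apply continuousOn_const)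
  have hstep : ∀ m, J m - J (m + 1) =
      contourIntegral θ (fun z => ((z - a)⁻¹) ^ (m + 1)) • (D ^ m) u := by
    intro m
    rw [hJ]
    dsimp only
    rw [contourIntegral_sub hθ (hcJ m) (hcJ (m + 1)), ← contourIntegral_smul_const]
    refine contourIntegral_congr fun t ht => ?_
    have h1 := DFunLike.congr_fun (resolvent_mul_sub (hT ⟨t, ht, rfl⟩)) ((D ^ m) u)
    have h2 : (algebraMap ℂ (V →L[ℂ] V) (θ t) - T) ((D ^ m) u) =
        (θ t - a) • (D ^ m) u - (D ^ (m + 1)) u := by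
      rw [pow_succ', hD]
      simp only [mul_apply_eq_comp, sub_apply,
        Algebra.algebraMap_eq_smul_one, smul_apply,
        one_apply_eq_self, sub_smul]
      abel
    rw [mul_apply_eq_comp, h2, map_sub, map_smul, one_apply_eq_self] at h1
    have h3 := congrArg (fun v => ((θ t - a)⁻¹) ^ (m + 1) • v) h1
    simp only [smul_sub, smul_smul] at h3
    rw [← h3, pow_succ, mul_assoc, inv_mul_cancel₀ (hne t ht), mul_one]
  have hJ0 : J 0 = spectralProjector T θ u := by
    rw [spectralProjector_apply hθ hT]
    simp [hJ]
  have h01 : J 0 - J 1 = windingNumber θ a • u := by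
    simpa [windingNumber] using hstep 0
  -- Only the first term of the expansion has a nonzero integral, so the remainders are constant
  -- from index 1 on. Their geometric decay then forces this constant to be 0.
  have hconst : ∀ m, J (m + 1) = J 1 := by
    intro m
    induction m with
    | zero => rfl
    | succ m ih =>
      have h := hstep (m + 1)
      have h0 : contourIntegral θ (fun z => ((z - a)⁻¹) ^ (m + 1 + 1)) = 0 := by
        rw [contourIntegral]
        simp only [smul_eq_mul]
        rw [integral_deriv_mul_inv_pow_eq_zero hθ hclosed ha (Nat.succ_ne_zero m), mul_zero]
      rw [h0, zero_smul, sub_eq_zero] at h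
      rw [← h, ih]
  obtain ⟨M, hM⟩ := isCompact_Icc.exists_bound_of_continuousOn hcr
  have hM0 : 0 ≤ M := (norm_nonneg _).trans (hM 0 (by simp))
  have hbound : ∀ m, ‖J m‖ ≤ K * (M * C) * (ρ / d) ^ m := by
    intro m
    have : ‖J m‖ ≤ K * (d⁻¹ ^ m * (M * (C * ρ ^ m))) := by
      refine norm_contourIntegral_le hθ fun t ht => ?_
      rw [norm_smul, norm_pow, norm_inv]
      have h1 : ‖resolvent T (θ t) ((D ^ m) u)‖ ≤ M * (C * ρ ^ m) :=
        (ContinuousLinearMap.le_opNorm _ _).trans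
          (mul_le_mul (hM t ht) (hu m) (norm_nonneg _) hM0)
      have h2 : ‖θ t - a‖⁻¹ ≤ d⁻¹ := inv_anti₀ hd0 (hd t ht)
      gcongr
    refine this.trans_eq ?_
    rw [div_pow, inv_pow]
    ring
  have hlim : Tendsto (fun m : ℕ => K * (M * C) * (ρ / d) ^ m) atTop (𝓝 0) := by
    simpa using (tendsto_pow_atTop_nhds_zero_of_lt_one (div_nonneg hρ hd0.le)
      ((div_lt_one hd0).2 hρd)).const_mul (K * (M * C))
  have hJ1 : J 1 = 0 := by
    have h := (tendsto_add_atTop_iff_nat 1).2 (squeeze_zero_norm hbound hlim)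
    simp only [hconst] at h
    exact tendsto_nhds_unique tendsto_const_nhds h
  rw [← hJ0, ← h01, hJ1, sub_zero]

/-- The spectral projector depends continuously on the operator. -/
theorem exists_norm_spectralProjector_sub_le {K : ℝ≥0} {θ : ℝ → ℂ}
    (hθ : LipschitzOnWith K θ (Icc 0 1))
    {T : V →L[ℂ] V} (hT : θ '' Icc 0 1 ⊆ resolventSet ℂ T) {ε : ℝ} (hε : 0 < ε) :
    ∃ η : ℝ, 0 < η ∧ ∀ S : V →L[ℂ] V, θ '' Icc 0 1 ⊆ resolventSet ℂ S → ‖S - T‖ < η →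
      ‖spectralProjector S θ - spectralProjector T θ‖ ≤ ε := by
  have hcr := continuousOn_resolvent_comp hθ.continuousOn hT
  obtain ⟨M, hM⟩ := isCompact_Icc.exists_bound_of_continuousOn hcr
  have hM0 : 0 ≤ M := (norm_nonneg _).trans (hM 0 (by simp))
  -- The first bound keeps the resolvent of S below 2M on the curve; the second makes the integrated
  -- difference at most ε.
  refine ⟨min (1 / (2 * (M + 1))) (ε / (2 * (K + 1) * (M + 1) ^ 2)), by positivity,
    fun S hS hη => ?_⟩
  obtain ⟨h1, h2⟩ := lt_min_iff.1 hη
  rw [spectralProjector, spectralProjector, contourIntegral_sub hθ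
    (continuousOn_resolvent_comp hθ.continuousOn hS) hcr]
  have hb : ∀ t ∈ Icc (0 : ℝ) 1, ‖resolvent S (θ t) - resolvent T (θ t)‖ ≤
      2 * M * ‖S - T‖ * M := by
    intro t ht
    have e : resolvent S (θ t) - resolvent T (θ t) =
        resolvent S (θ t) * (S - T) * resolvent T (θ t) :=
      spectrum.resolvent_sub_resolvent (hS ⟨t, ht, rfl⟩) (hT ⟨t, ht, rfl⟩)
    have e1 : ‖resolvent S (θ t) - resolvent T (θ t)‖ ≤ ‖resolvent S (θ t)‖ * ‖S - T‖ * M := by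
      rw [e]
      refine (norm_mul_le _ _).trans ?_
      have := hM t ht
      gcongr
      exact norm_mul_le _ _
    -- A bootstrap: by `e3` the last term is at most half of the left side and is absorbed.
    have e2 : ‖resolvent S (θ t)‖ ≤ M + ‖resolvent S (θ t)‖ * ‖S - T‖ * M := by
      have := norm_le_norm_add_norm_sub' (resolvent S (θ t)) (resolvent T (θ t))
      linarith [hM t ht]
    have e3 : ‖S - T‖ * M ≤ 1 / 2 := by
      calc ‖S - T‖ * M ≤ 1 / (2 * (M + 1)) * (M + 1) := by gcongr; linarith
        _ = 1 / 2 := by field_simp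
    have e4 : ‖resolvent S (θ t)‖ ≤ 2 * M := by
      have := mul_le_mul_of_nonneg_left e3 (norm_nonneg (resolvent S (θ t)))
      rw [← mul_assoc] at this
      linarith
    refine e1.trans ?_
    gcongr
  refine (norm_contourIntegral_le hθ hb).trans ?_
  calc K * (2 * M * ‖S - T‖ * M) ≤
      (K + 1) * (2 * (M + 1) * (ε / (2 * (K + 1) * (M + 1) ^ 2)) * (M + 1)) := by
        gcongr <;> linarith
    _ = ε := by field_simp

end Resolvents

/-! ### Growth of powers -/

section Growth

/-- Gelfand's formula gives the bound with constant 1 for large n; the finite sum in the constant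
covers the remaining powers. -/
theorem exists_norm_pow_le {B : Type*} [NormedRing B] [NormedAlgebra ℂ B] [CompleteSpace B]
    (a : B) {ρ : ℝ} (hρ : 0 < ρ) (h : ∀ z ∈ spectrum ℂ a, ‖z‖ < ρ) :
    ∃ C : ℝ, 0 ≤ C ∧ ∀ n : ℕ, ‖a ^ n‖ ≤ C * ρ ^ n := by
  rcases subsingleton_or_nontrivial B with hB | hB
  · exact ⟨0, le_rfl, fun n => by simp [Subsingleton.elim (a ^ n) 0]⟩
  lift ρ to ℝ≥0 using hρ.le
  have hr : spectralRadius ℂ a < (ρ : ℝ≥0∞) :=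
    spectrum.spectralRadius_lt_of_forall_lt a fun z hz => NNReal.coe_lt_coe.1 (h z hz)
  have hev := (spectrum.pow_nnnorm_pow_one_div_tendsto_nhds_spectralRadius a).eventually_lt_const hr
  have hev' : ∀ᶠ n : ℕ in atTop, ‖a ^ n‖ ≤ ρ ^ n := by
    filter_upwards [hev, eventually_gt_atTop 0] with n hn hn0
    have h1 : ((‖a ^ n‖₊ : ℝ≥0∞) ^ (1 / n : ℝ)) ^ (n : ℝ) ≤ (ρ : ℝ≥0∞) ^ (n : ℝ) :=
      ENNReal.rpow_le_rpow hn.le (Nat.cast_nonneg n)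
    rw [← ENNReal.rpow_mul, one_div, inv_mul_cancel₀ (by positivity), ENNReal.rpow_one,
      ENNReal.rpow_natCast, ← ENNReal.coe_pow, ENNReal.coe_le_coe] at h1
    exact_mod_cast h1
  obtain ⟨n₀, hn₀⟩ := eventually_atTop.1 hev'
  refine ⟨1 + ∑ i ∈ Finset.range n₀, ‖a ^ i‖ / ρ ^ i, by positivity, fun n => ?_⟩
  have hpos : 0 < ρ ^ n := pow_pos hρ n
  rcases le_or_gt n₀ n with hn | hn
  · calc ‖a ^ n‖ ≤ 1 * ρ ^ n := by simpa using hn₀ n hn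
      _ ≤ _ := by
        gcongr
        simpa using Finset.sum_nonneg fun i (_ : i ∈ Finset.range n₀) =>
          (show 0 ≤ ‖a ^ i‖ / ρ ^ i by positivity)
  · calc ‖a ^ n‖ = ‖a ^ n‖ / ρ ^ n * ρ ^ n := by field_simp
      _ ≤ _ := by
        gcongr
        have := Finset.single_le_sum (f := fun i => ‖a ^ i‖ / ρ ^ i)
          (fun i _ => by positivity) (Finset.mem_range.2 hn)
        linarith

end Growth

/-! ### Growth on kernels of polynomials in an operator -/

section Restriction

variable {V : Type*} [NormedAddCommGroup V] [NormedSpace ℂ V]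

/-- The restriction of a bounded operator to an invariant subspace. -/
noncomputable def restrictInvariant (T : V →L[ℂ] V) (K : Submodule ℂ V) (h : ∀ u ∈ K, T u ∈ K) :
    K →L[ℂ] K :=
  (T.comp K.subtypeL).codRestrict K fun u => h u u.2

theorem coe_restrictInvariant_apply {T : V →L[ℂ] V} {K : Submodule ℂ V} (h : ∀ u ∈ K, T u ∈ K)
    (u : K) : (restrictInvariant T K h u : V) = T u := rfl

theorem coe_restrictInvariant_pow_apply {T : V →L[ℂ] V} {K : Submodule ℂ V}
    (h : ∀ u ∈ K, T u ∈ K) (n : ℕ) (u : K) :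
    ((restrictInvariant T K h ^ n) u : V) = (T ^ n) u := by
  induction n with
  | zero => simp
  | succ n ih =>
    rw [pow_succ', pow_succ', mul_apply_eq_comp, mul_apply_eq_comp, coe_restrictInvariant_apply, ih]

theorem coe_aeval_restrictInvariant_apply {T : V →L[ℂ] V} {K : Submodule ℂ V}
    (h : ∀ u ∈ K, T u ∈ K) (p : Polynomial ℂ) (u : K) :
    (Polynomial.aeval (restrictInvariant T K h) p u : V) = Polynomial.aeval T p u := by
  induction p using Polynomial.induction_on' with
  | add p q hp hq => simp [hp, hq]
  | monomial n a =>
    rw [Polynomial.aeval_monomial, Polynomial.aeval_monomial, mul_apply_eq_comp, mul_apply_eq_comp,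
      Algebra.algebraMap_eq_smul_one, Algebra.algebraMap_eq_smul_one, smul_apply, smul_apply,
      one_apply_eq_self, one_apply_eq_self, Submodule.coe_smul, coe_restrictInvariant_pow_apply]

/-- The kernel of `p(T)`. -/
noncomputable def kerAeval (T : V →L[ℂ] V) (p : Polynomial ℂ) : Submodule ℂ V :=
  LinearMap.ker (Polynomial.aeval T p : V →ₗ[ℂ] V)

theorem mem_kerAeval {T : V →L[ℂ] V} {p : Polynomial ℂ} {u : V} :
    u ∈ kerAeval T p ↔ Polynomial.aeval T p u = 0 := LinearMap.mem_ker

theorem isClosed_kerAeval (T : V →L[ℂ] V) (p : Polynomial ℂ) :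
    IsClosed (kerAeval T p : Set V) :=
  (Polynomial.aeval T p).isClosed_ker

theorem aeval_mem_kerAeval {T : V →L[ℂ] V} {p : Polynomial ℂ} (q : Polynomial ℂ) {u : V}
    (hu : u ∈ kerAeval T p) : Polynomial.aeval T q u ∈ kerAeval T p := by
  rw [mem_kerAeval] at hu ⊢
  rw [← mul_apply_eq_comp, ← map_mul, mul_comm, map_mul, mul_apply_eq_comp, hu, map_zero]

theorem apply_mem_kerAeval {T : V →L[ℂ] V} {p : Polynomial ℂ} {u : V}
    (hu : u ∈ kerAeval T p) : T u ∈ kerAeval T p := by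
  simpa using aeval_mem_kerAeval Polynomial.X hu

theorem pow_apply_mem_kerAeval {T : V →L[ℂ] V} {p : Polynomial ℂ} (n : ℕ) {u : V}
    (hu : u ∈ kerAeval T p) : (T ^ n) u ∈ kerAeval T p := by
  simpa using aeval_mem_kerAeval (Polynomial.X ^ n) hu

theorem isRoot_of_mem_spectrum_of_aeval_eq_zero {B : Type*} [Ring B] [Algebra ℂ B] {R : B}
    {p : Polynomial ℂ} (hp : Polynomial.aeval R p = 0) {z : ℂ} (hz : z ∈ spectrum ℂ R) :
    p.IsRoot z := by
  have h := spectrum.subset_polynomial_aeval R p ⟨z, hz, rfl⟩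
  rw [hp] at h
  have : Nontrivial B := by
    by_contra hn
    rw [not_nontrivial_iff_subsingleton] at hn
    rw [spectrum.of_subsingleton] at hz
    exact hz
  rwa [spectrum.zero_eq] at h

theorem exists_norm_pow_apply_le_of_aeval_eq_zero {X : Type*} [NormedAddCommGroup X]
    [NormedSpace ℂ X] [CompleteSpace X] {R : X →L[ℂ] X} {p : Polynomial ℂ}
    (hp : Polynomial.aeval R p = 0) {ρ : ℝ} (hρ : 0 < ρ) (h : ∀ z, p.IsRoot z → ‖z‖ < ρ) :
    ∃ C : ℝ, 0 ≤ C ∧ ∀ (u : X) (n : ℕ), ‖(R ^ n) u‖ ≤ C * ρ ^ n * ‖u‖ := by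
  obtain ⟨C, hC, hb⟩ := exists_norm_pow_le R hρ fun z hz =>
    h z (isRoot_of_mem_spectrum_of_aeval_eq_zero hp hz)
  exact ⟨C, hC, fun u n => (ContinuousLinearMap.le_opNorm _ _).trans
    (mul_le_mul_of_nonneg_right (hb n) (norm_nonneg _))⟩

/-- The spectrum lies among the roots of `p`, so R is invertible and its inverse has its spectrum in
the open disc of radius ρ⁻¹. The upper growth bound for the inverse is the lower bound for R. -/
theorem exists_le_norm_pow_apply_of_aeval_eq_zero {X : Type*} [NormedAddCommGroup X]
    [NormedSpace ℂ X] [CompleteSpace X] {R : X →L[ℂ] X} {p : Polynomial ℂ}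
    (hp : Polynomial.aeval R p = 0) {ρ : ℝ} (hρ : 0 < ρ) (h : ∀ z, p.IsRoot z → ρ < ‖z‖) :
    (∃ C : ℝ, 0 ≤ C ∧ ∀ (u : X) (n : ℕ), ρ ^ n * ‖u‖ ≤ C * ‖(R ^ n) u‖) ∧
      ∀ (u : X) (n : ℕ), ∃ v, (R ^ n) v = u := by
  have hunit : IsUnit R := by
    rw [← spectrum.zero_notMem_iff ℂ]
    intro h0
    have := h 0 (isRoot_of_mem_spectrum_of_aeval_eq_zero hp h0)
    rw [norm_zero] at this
    exact lt_asymm hρ this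
  obtain ⟨b, rfl⟩ := hunit
  set b' : X →L[ℂ] X := ((b⁻¹ : (X →L[ℂ] X)ˣ) : X →L[ℂ] X) with hb'
  have hspec : ∀ z ∈ spectrum ℂ b', ‖z‖ < ρ⁻¹ := by
    intro z hz
    rw [hb', ← spectrum.map_inv, Set.mem_inv] at hz
    have := h _ (isRoot_of_mem_spectrum_of_aeval_eq_zero hp hz)
    rw [norm_inv] at this
    exact (lt_inv_comm₀ hρ (inv_pos.1 (hρ.trans this))).1 this
  obtain ⟨C, hC, hbound⟩ := exists_norm_pow_le _ (inv_pos.2 hρ) hspec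
  have hcancel : ∀ (n : ℕ) (u : X), ((b : X →L[ℂ] X) ^ n) ((b' ^ n) u) = u := by
    intro n u
    rw [← mul_apply_eq_comp, hb', ← Units.val_pow_eq_pow_val, ← Units.val_pow_eq_pow_val, inv_pow,
      Units.mul_inv, one_apply_eq_self]
  have hcancel' : ∀ (n : ℕ) (u : X), (b' ^ n) (((b : X →L[ℂ] X) ^ n) u) = u := by
    intro n u
    rw [← mul_apply_eq_comp, hb', ← Units.val_pow_eq_pow_val, ← Units.val_pow_eq_pow_val, inv_pow,
      Units.inv_mul, one_apply_eq_self]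
  refine ⟨⟨C, hC, fun u n => ?_⟩, fun u n => ⟨_, hcancel n u⟩⟩
  have h2 := (ContinuousLinearMap.le_opNorm _ _).trans
    (mul_le_mul_of_nonneg_right (hbound n) (norm_nonneg (((b : X →L[ℂ] X) ^ n) u)))
  rw [hcancel'] at h2
  calc ρ ^ n * ‖u‖ ≤ ρ ^ n * (C * ρ⁻¹ ^ n * ‖((b : X →L[ℂ] X) ^ n) u‖) := by gcongr
    _ = C * ‖((b : X →L[ℂ] X) ^ n) u‖ := by rw [inv_pow]; field_simp

theorem aeval_restrictInvariant_kerAeval (T : V →L[ℂ] V) (p : Polynomial ℂ) :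
    Polynomial.aeval (restrictInvariant T (kerAeval T p) fun _ => apply_mem_kerAeval) p = 0 := by
  ext u
  rw [coe_aeval_restrictInvariant_apply, mem_kerAeval.1 u.2]
  rfl

variable [CompleteSpace V]

/-- If all roots of `p` lie in the disc of radius `ρ` about `c`, then the powers of `T - c` grow at
most like `ρⁿ` on the kernel of `p(T)`. -/
theorem exists_norm_sub_pow_apply_le (T : V →L[ℂ] V) (p : Polynomial ℂ) (c : ℂ) {ρ : ℝ}
    (hρ : 0 < ρ) (h : ∀ z, p.IsRoot z → ‖z - c‖ < ρ) :
    ∃ C : ℝ, 0 ≤ C ∧ ∀ u ∈ kerAeval T p, ∀ n : ℕ,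
      ‖((T - algebraMap ℂ _ c) ^ n) u‖ ≤ C * ρ ^ n * ‖u‖ := by
  set F := T - algebraMap ℂ (V →L[ℂ] V) c with hF
  -- Translation moves the centre `c` to 0 without changing the kernel.
  set q := p.comp (Polynomial.X + Polynomial.C c) with hq
  have hker : kerAeval F q = kerAeval T p := by
    rw [kerAeval, kerAeval, hq, Polynomial.aeval_comp, map_add, Polynomial.aeval_X,
      Polynomial.aeval_C, hF, sub_add_cancel]
  have := (isClosed_kerAeval F q).completeSpace_coe
  obtain ⟨C, hC, hb⟩ := exists_norm_pow_apply_le_of_aeval_eq_zero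
    (aeval_restrictInvariant_kerAeval F q) hρ fun z hz => by
      rw [hq, Polynomial.IsRoot, Polynomial.eval_comp] at hz
      simpa using h (z + c) (by simpa using hz)
  refine ⟨C, hC, fun u hu n => ?_⟩
  rw [← hker] at hu
  have h1 := hb ⟨u, hu⟩ n
  rwa [Submodule.coe_norm, coe_restrictInvariant_pow_apply] at h1

/-- If all roots of `p` lie outside the disc of radius `ρ`, then `T` is bijective on the kernel of
`p(T)` and its powers grow at least like `ρⁿ` there. -/
theorem exists_le_norm_pow_apply (T : V →L[ℂ] V) (p : Polynomial ℂ) {ρ : ℝ}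
    (hρ : 0 < ρ) (h : ∀ z, p.IsRoot z → ρ < ‖z‖) :
    (∃ C : ℝ, 0 ≤ C ∧ ∀ u ∈ kerAeval T p, ∀ n : ℕ, ρ ^ n * ‖u‖ ≤ C * ‖(T ^ n) u‖) ∧
      ∀ u ∈ kerAeval T p, ∀ n : ℕ, ∃ v ∈ kerAeval T p, (T ^ n) v = u := by
  have := (isClosed_kerAeval T p).completeSpace_coe
  obtain ⟨⟨C, hC, hb⟩, hsurj⟩ := exists_le_norm_pow_apply_of_aeval_eq_zero
    (aeval_restrictInvariant_kerAeval T p) hρ h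
  refine ⟨⟨C, hC, fun u hu n => ?_⟩, fun u hu n => ?_⟩
  · have h1 := hb ⟨u, hu⟩ n
    rwa [Submodule.coe_norm, Submodule.coe_norm, coe_restrictInvariant_pow_apply] at h1
  · obtain ⟨v, hv⟩ := hsurj ⟨u, hu⟩ n
    refine ⟨v, v.2, ?_⟩
    rw [← coe_restrictInvariant_pow_apply (fun _ => apply_mem_kerAeval), hv]

end Restriction

/-! ### Operators annihilated by a polynomial -/

section Algebraic

variable {V : Type*} [NormedAddCommGroup V] [NormedSpace ℂ V]

theorem exists_add_of_isCoprime {T : V →L[ℂ] V} {f g : Polynomial ℂ} (hfg : IsCoprime f g) {u : V}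
    (hu : u ∈ kerAeval T (f * g)) : ∃ v ∈ kerAeval T f, ∃ w ∈ kerAeval T g, v + w = u := by
  obtain ⟨a, b, hab⟩ := hfg
  rw [mem_kerAeval] at hu
  refine ⟨Polynomial.aeval T (b * g) u, ?_, Polynomial.aeval T (a * f) u, ?_, ?_⟩
  · rw [mem_kerAeval, ← mul_apply_eq_comp, ← map_mul,
      show f * (b * g) = b * (f * g) by ring, map_mul, mul_apply_eq_comp, hu, map_zero]
  · rw [mem_kerAeval, ← mul_apply_eq_comp, ← map_mul,
      show g * (a * f) = a * (f * g) by ring, map_mul, mul_apply_eq_comp, hu, map_zero]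
  · have := DFunLike.congr_fun (congrArg (Polynomial.aeval T) hab) u
    rw [map_add, add_apply, map_one, one_apply_eq_self] at this
    rw [add_comm, this]

/-- The kernel of `f(T)` is spanned by generalized eigenvectors for roots of `f`. -/
theorem kerAeval_le_of_forall_isRoot {T : V →L[ℂ] V} {W : Submodule ℂ V} {f : Polynomial ℂ}
    (hf : f ≠ 0)
    (h : ∀ z, f.IsRoot z → ∀ n : ℕ, kerAeval T ((Polynomial.X - Polynomial.C z) ^ n) ≤ W) :
    kerAeval T f ≤ W := by
  induction hd : f.natDegree using Nat.strong_induction_on generalizing f with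
  | _ d ih =>
    subst hd
    by_cases h0 : f.degree = 0
    · obtain ⟨c, hc⟩ : ∃ c, f = Polynomial.C c := ⟨_, Polynomial.eq_C_of_degree_eq_zero h0⟩
      have hc0 : c ≠ 0 := by
        rintro rfl
        exact hf (by simp [hc])
      intro u hu
      rw [mem_kerAeval, hc, Polynomial.aeval_C, Algebra.algebraMap_eq_smul_one, smul_apply,
        one_apply_eq_self, smul_eq_zero] at hu
      rw [hu.resolve_left hc0]
      exact W.zero_mem
    · obtain ⟨z, hz⟩ := IsAlgClosed.exists_root f h0
      obtain ⟨g, hg, hndvd⟩ := Polynomial.exists_eq_pow_rootMultiplicity_mul_and_not_dvd f hf z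
      have hn : 0 < f.rootMultiplicity z := (Polynomial.rootMultiplicity_pos hf).2 hz
      set n := f.rootMultiplicity z
      have hg0 : g ≠ 0 := by
        rintro rfl
        simp at hndvd
      have hcop : IsCoprime ((Polynomial.X - Polynomial.C z) ^ n) g :=
        ((Polynomial.irreducible_X_sub_C z).coprime_iff_not_dvd.2 hndvd).pow_left
      have hdeg : g.natDegree < f.natDegree := by
        rw [hg, Polynomial.natDegree_mul (pow_ne_zero _ (Polynomial.X_sub_C_ne_zero z)) hg0,
          Polynomial.natDegree_pow, Polynomial.natDegree_X_sub_C]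
        omega
      have hgW : kerAeval T g ≤ W := ih _ hdeg hg0 (fun y hy => h y (by
        rw [hg]
        exact Polynomial.root_mul_left_of_isRoot _ hy)) rfl
      intro u hu
      rw [hg] at hu
      obtain ⟨v, hv, w, hw, rfl⟩ := exists_add_of_isCoprime hcop hu
      exact W.add_mem (h z hz n hv) (hgW hw)

/-- F = T - c maps V into W. If q annihilates the restriction of F to W, then q(F)F = 0 on V; hence
the extra factor X. -/
theorem isIntegral_of_sub_mem_finiteDimensional {T : V →L[ℂ] V} {c : ℂ} {W : Submodule ℂ V}
    [FiniteDimensional ℂ W] (h : ∀ u, T u - c • u ∈ W) : IsIntegral ℂ T := by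
  set F : V →L[ℂ] V := T - algebraMap ℂ _ c with hF
  have hFW : ∀ u, F u ∈ W := fun u => by
    simpa [hF, Algebra.algebraMap_eq_smul_one] using h u
  set G := restrictInvariant F W fun u _ => hFW u with hG
  have : FiniteDimensional ℂ (W →L[ℂ] W) := inferInstance
  obtain ⟨q, hq, hq0⟩ := Algebra.IsIntegral.isIntegral (R := ℂ) G
  refine ⟨(q * Polynomial.X).comp (Polynomial.X - Polynomial.C c),
    (hq.mul Polynomial.monic_X).comp (Polynomial.monic_X_sub_C c)
      (by rw [Polynomial.natDegree_X_sub_C]; exact one_ne_zero), ?_⟩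
  ext u
  rw [← Polynomial.aeval_def, Polynomial.aeval_comp, map_sub, Polynomial.aeval_X,
    Polynomial.aeval_C, ← hF, map_mul, mul_apply_eq_comp, Polynomial.aeval_X,
    ← coe_aeval_restrictInvariant_apply (fun u _ => hFW u) q ⟨F u, hFW u⟩, ← hG,
    Polynomial.aeval_def, hq0]
  rfl

/-- If z - T were invertible, the factor X - z could be cancelled, contradicting minimality of the
degree. -/
theorem mem_spectrum_of_isRoot_minpoly {T : V →L[ℂ] V} (hT : IsIntegral ℂ T) {z : ℂ}
    (hz : (minpoly ℂ T).IsRoot z) : z ∈ spectrum ℂ T := by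
  by_contra hns
  rw [spectrum.notMem_iff] at hns
  obtain ⟨g, hg⟩ := Polynomial.dvd_iff_isRoot.2 hz
  have h1 : Polynomial.aeval T g = 0 := by
    have h0 := minpoly.aeval ℂ T
    rw [hg, map_mul, map_sub, Polynomial.aeval_X, Polynomial.aeval_C, ← neg_sub, neg_mul,
      neg_eq_zero] at h0
    exact (hns.mul_right_eq_zero).1 h0
  have hg0 : g ≠ 0 := by
    rintro rfl
    exact minpoly.ne_zero hT (by simpa using hg)
  have h2 := Polynomial.natDegree_le_of_dvd (minpoly.dvd ℂ T h1) hg0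
  rw [hg, Polynomial.natDegree_mul (Polynomial.X_sub_C_ne_zero z) hg0,
    Polynomial.natDegree_X_sub_C] at h2
  omega

/-- A decomposition of an algebraic operator whose spectrum splits into two parts. -/
theorem exists_isCoprime_aeval_mul_eq_zero {T : V →L[ℂ] V} (hT : IsIntegral ℂ T) (p : ℂ → Prop) :
    ∃ f g : Polynomial ℂ, f ≠ 0 ∧ g ≠ 0 ∧ IsCoprime f g ∧ Polynomial.aeval T (f * g) = 0 ∧
      (∀ z, f.IsRoot z → z ∈ spectrum ℂ T ∧ p z) ∧
      ∀ z, g.IsRoot z → z ∈ spectrum ℂ T ∧ ¬ p z := by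
  classical
  set s := (minpoly ℂ T).roots with hs
  set F : Multiset ℂ → Polynomial ℂ := fun s => (s.map fun z => Polynomial.X - Polynomial.C z).prod
  have hF : ∀ s : Multiset ℂ, F s ≠ 0 := fun s => (Polynomial.monic_multisetProd_X_sub_C s).ne_zero
  have hroot : ∀ (s : Multiset ℂ) z, (F s).IsRoot z ↔ z ∈ s := fun s z => by
    rw [← Polynomial.mem_roots (hF s), Polynomial.roots_multiset_prod_X_sub_C]
  -- The roots are sorted by `p` with their multiplicities, so the two factors share none.
  have hfac : F (s.filter p) * F (s.filter fun z => ¬ p z) = minpoly ℂ T := by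
    rw [← Multiset.prod_add, ← Multiset.map_add, Multiset.filter_add_not]
    exact ((IsAlgClosed.splits (minpoly ℂ T)).eq_prod_roots_of_monic (minpoly.monic hT)).symm
  have hspec : ∀ z ∈ s, z ∈ spectrum ℂ T := fun z hz =>
    mem_spectrum_of_isRoot_minpoly hT (Polynomial.isRoot_of_mem_roots hz)
  refine ⟨F (s.filter p), F (s.filter fun z => ¬ p z), hF _, hF _, ?_, ?_, ?_, ?_⟩
  · rw [Polynomial.isCoprime_iff_aeval_ne_zero_of_isAlgClosed ℂ ℂ]
    intro z
    by_contra! hz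
    rw [Polynomial.coe_aeval_eq_eval] at hz
    have h1 := (hroot _ z).1 hz.1
    have h2 := (hroot _ z).1 hz.2
    exact (Multiset.mem_filter.1 h2).2 (Multiset.mem_filter.1 h1).2
  · rw [hfac, minpoly.aeval]
  · intro z hz
    have := Multiset.mem_filter.1 ((hroot _ z).1 hz)
    exact ⟨hspec z this.1, this.2⟩
  · intro z hz
    have := Multiset.mem_filter.1 ((hroot _ z).1 hz)
    exact ⟨hspec z this.1, this.2⟩

end Algebraic

/-! ### Isolated spectral points under a continuous embedding -/

section IsolatedPoints

variable {X Y : Type*} [NormedAddCommGroup X] [NormedSpace ℂ X] [CompleteSpace X]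
  [NormedAddCommGroup Y] [NormedSpace ℂ Y] [CompleteSpace Y]

/-- Let `B` be the restriction of `S` to a continuously embedded subspace. A point of the resolvent
set of `S` is not an isolated point of the spectrum of `B`. -/
theorem mem_resolventSet_of_intertwining {j : X →L[ℂ] Y} (hj : Function.Injective j)
    {B : X →L[ℂ] X} {S : Y →L[ℂ] Y} (h : ∀ x, j (B x) = S (j x)) {c : ℂ}
    (hS : c ∈ resolventSet ℂ S) (hB : ∀ᶠ z in 𝓝[≠] c, z ∈ resolventSet ℂ B) :
    c ∈ resolventSet ℂ B := by
  obtain ⟨r₁, hr₁, hb₁⟩ := Metric.nhds_basis_closedBall.mem_iff.1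
    ((spectrum.isOpen_resolventSet S).mem_nhds hS)
  obtain ⟨r₂, hr₂, hb₂⟩ := Metric.nhds_basis_closedBall.mem_iff.1
    (eventually_nhdsWithin_iff.1 hB)
  set r := min r₁ r₂
  have hr : 0 < r := lt_min hr₁ hr₂
  have hsS : Metric.closedBall c r ⊆ resolventSet ℂ S :=
    (Metric.closedBall_subset_closedBall (min_le_left _ _)).trans hb₁
  have hsB : Metric.sphere c r ⊆ resolventSet ℂ B := fun z hz =>
    hb₂ (Metric.closedBall_subset_closedBall (min_le_right _ _) (Metric.sphere_subset_closedBall hz))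
      (Metric.ne_of_mem_sphere hz hr.ne')
  have hres : ContinuousOn (resolvent B) (Metric.sphere c r) := fun z hz =>
    (spectrum.hasDerivAt_resolvent_const_left (hsB hz)).continuousAt.continuousWithinAt
  have hci : CircleIntegrable (resolvent B) c r := hres.circleIntegrable hr.le
  have hres' : ContinuousOn (fun z => (z - c)⁻¹ • resolvent B z) (Metric.sphere c r) :=
    ((continuousOn_id.sub continuousOn_const).inv₀ fun z hz =>
      sub_ne_zero.2 (Metric.ne_of_mem_sphere hz hr.ne')).smul hres
  have hci' : CircleIntegrable (fun z => (z - c)⁻¹ • resolvent B z) c r :=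
    hres'.circleIntegrable hr.le
  have hcirc : ∀ (f : ℂ → X →L[ℂ] X), CircleIntegrable f c r → ∀ L : (X →L[ℂ] X) →L[ℂ] (X →L[ℂ] Y),
      L (∮ z in C(c, r), f z) = ∮ z in C(c, r), L (f z) := by
    intro f hf L
    rw [circleIntegral, circleIntegral, ← L.intervalIntegral_comp_comm hf.out]
    simp
  -- After composition with `j`, the resolvent of B becomes that of S, holomorphic on the whole
  -- disc. Cauchy's theorem and injectivity of `j` make the Riesz projection vanish.
  have hP : (∮ z in C(c, r), resolvent B z) = 0 := by
    have h1 := hcirc _ hci (ContinuousLinearMap.compL ℂ X X Y j)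
    have h2 : (∮ z in C(c, r), (ContinuousLinearMap.compL ℂ X X Y j) (resolvent B z)) =
        ∮ z in C(c, r), (resolvent S z).comp j := by
      refine circleIntegral.integral_congr hr.le fun z hz => ?_
      have hzS := hsS (Metric.sphere_subset_closedBall hz)
      ext x
      have h3 := DFunLike.congr_fun (sub_mul_resolvent (hsB hz)) x
      have h4 := DFunLike.congr_fun (resolvent_mul_sub hzS) (j (resolvent B z x))
      rw [mul_apply_eq_comp, one_apply_eq_self] at h3 h4
      rw [ContinuousLinearMap.compL_apply, ContinuousLinearMap.comp_apply,
        ContinuousLinearMap.comp_apply, ← h4]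
      have h5 : (algebraMap ℂ (Y →L[ℂ] Y) z - S) (j (resolvent B z x)) =
          j ((algebraMap ℂ (X →L[ℂ] X) z - B) (resolvent B z x)) := by
        rw [sub_apply, sub_apply, map_sub, h, Algebra.algebraMap_eq_smul_one,
          Algebra.algebraMap_eq_smul_one, smul_apply, smul_apply, one_apply_eq_self,
          one_apply_eq_self, map_smul]
      rw [h5, h3]
    have h3 : (∮ z in C(c, r), (resolvent S z).comp j) = 0 := by
      refine DiffContOnCl.circleIntegral_eq_zero hr.le (DifferentiableOn.diffContOnCl ?_)
      rw [closure_ball c hr.ne']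
      intro z hz
      exact ((spectrum.hasDerivAt_resolvent_const_left (hsS hz)).differentiableAt.clm_comp
        (differentiableAt_const j)).differentiableWithinAt
    rw [h2, h3] at h1
    ext x
    have := DFunLike.congr_fun h1 x
    exact hj (by simpa using this)
  -- D/(2πi) is the inverse of c - B: since (c - B)R(z) = 1 - (z - c)R(z), the product (c - B)D
  -- equals 2πi minus the integral of the resolvent, which is 0.
  set D := ∮ z in C(c, r), (z - c)⁻¹ • resolvent B z with hD
  have hmul : ∀ L : (X →L[ℂ] X) →L[ℂ] (X →L[ℂ] X),
      (∀ z ∈ Metric.sphere c r, L (resolvent B z) = 1 - (z - c) • resolvent B z) →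
      L D = (2 * Real.pi * Complex.I : ℂ) • 1 := by
    intro L hL
    have h1 : L D = ∮ z in C(c, r), L ((z - c)⁻¹ • resolvent B z) := by
      rw [hD, circleIntegral, circleIntegral, ← L.intervalIntegral_comp_comm hci'.out]
      simp
    have h2 : (∮ z in C(c, r), L ((z - c)⁻¹ • resolvent B z)) =
        ∮ z in C(c, r), ((z - c)⁻¹ • (1 : X →L[ℂ] X) - resolvent B z) := by
      refine circleIntegral.integral_congr hr.le fun z hz => ?_
      rw [map_smul, hL z hz, smul_sub, smul_smul,
        inv_mul_cancel₀ (sub_ne_zero.2 (Metric.ne_of_mem_sphere hz hr.ne')), one_smul]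
    have hci1 : CircleIntegrable (fun z => (z - c)⁻¹ • (1 : X →L[ℂ] X)) c r :=
      (((continuousOn_id.sub continuousOn_const).inv₀ fun z hz =>
        sub_ne_zero.2 (Metric.ne_of_mem_sphere hz hr.ne')).smul
          continuousOn_const).circleIntegrable hr.le
    rw [h1, h2, circleIntegral.integral_sub hci1 hci, hP, sub_zero,
      circleIntegral.integral_smul_const,
      circleIntegral.integral_sub_inv_of_mem_ball (Metric.mem_ball_self hr)]
  have hshift : ∀ z : ℂ, algebraMap ℂ (X →L[ℂ] X) c - B =
      (algebraMap ℂ (X →L[ℂ] X) z - B) - (z - c) • (1 : X →L[ℂ] X) := by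
    intro z
    rw [Algebra.algebraMap_eq_smul_one, Algebra.algebraMap_eq_smul_one, sub_smul]
    abel
  have hl := hmul (ContinuousLinearMap.mul ℂ (X →L[ℂ] X) (algebraMap ℂ _ c - B)) fun z hz => by
    rw [ContinuousLinearMap.mul_apply', hshift z, sub_mul, sub_mul_resolvent (hsB hz),
      smul_mul_assoc, one_mul]
  have hr' := hmul ((ContinuousLinearMap.mul ℂ (X →L[ℂ] X)).flip (algebraMap ℂ _ c - B))
    fun z hz => by
      rw [ContinuousLinearMap.flip_apply, ContinuousLinearMap.mul_apply', hshift z, mul_sub,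
        resolvent_mul_sub (hsB hz), mul_smul_comm, mul_one]
  rw [ContinuousLinearMap.mul_apply'] at hl
  rw [ContinuousLinearMap.flip_apply, ContinuousLinearMap.mul_apply'] at hr'
  have hne : (2 * Real.pi * Complex.I : ℂ) ≠ 0 := Complex.two_pi_I_ne_zero
  refine spectrum.mem_resolventSet_of_left_right_inverse
    (b := (2 * Real.pi * Complex.I : ℂ)⁻¹ • D) (c := (2 * Real.pi * Complex.I : ℂ)⁻¹ • D) ?_ ?_
  · rw [mul_smul_comm, hl, smul_smul, inv_mul_cancel₀ hne, one_smul]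
  · rw [smul_mul_assoc, hr', smul_smul, inv_mul_cancel₀ hne, one_smul]

end IsolatedPoints

/-! ### Convergence of subspace iteration -/

section GapConvergence

variable {V : Type*} [NormedAddCommGroup V] [InnerProductSpace ℂ V]

theorem mem_iterates_iff {T : V →L[ℂ] V} {E₀ : Submodule ℂ V} {l : ℕ} {v : V} :
    v ∈ iterates T E₀ l ↔ ∃ u ∈ E₀, (T ^ l) u = v := by
  induction l generalizing v with
  | zero => simp [iterates]
  | succ l ih =>
    rw [iterates, Submodule.mem_map]
    constructor
    · rintro ⟨y, hy, rfl⟩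
      obtain ⟨u, hu, rfl⟩ := ih.1 hy
      exact ⟨u, hu, by rw [pow_succ', mul_apply_eq_comp]; rfl⟩
    · rintro ⟨u, hu, rfl⟩
      exact ⟨(T ^ l) u, ih.2 ⟨u, hu, rfl⟩, by rw [pow_succ', mul_apply_eq_comp]; rfl⟩

theorem oneSidedGap_nonneg (M L : Submodule ℂ V) : 0 ≤ oneSidedGap M L :=
  Real.sSup_nonneg (by rintro _ ⟨x, _, rfl⟩; exact Metric.infDist_nonneg)

theorem oneSidedGap_le {M L : Submodule ℂ V} {c : ℝ} (hc : 0 ≤ c)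
    (h : ∀ x ∈ M, ‖x‖ = 1 → ∃ y ∈ L, ‖x - y‖ ≤ c) : oneSidedGap M L ≤ c := by
  refine Real.sSup_le ?_ hc
  rintro _ ⟨x, ⟨hxM, hx1⟩, rfl⟩
  obtain ⟨y, hy, hxy⟩ := h x hxM hx1
  refine (Metric.infDist_le_dist_of_mem (s := (L : Set V)) hy).trans ?_
  rwa [dist_eq_norm]

/-- Convergence of subspace iteration: the iterates of `E₀` converge to `K`, if `P` maps `E₀`
bijectively onto `K` along a subspace on which `T` grows more slowly than on `K`. -/
theorem tendsto_gap_iterates {T P : V →L[ℂ] V} {K L E₀ : Submodule ℂ V}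
    [FiniteDimensional ℂ E₀] (hmap : E₀.map (P : V →ₗ[ℂ] V) = K)
    (hinj : ∀ u ∈ E₀, P u = 0 → u = 0)
    (hL : ∀ u, u - P u ∈ L) (hPK : ∀ u ∈ K, P u = u) (hPL : ∀ u ∈ L, P u = 0)
    (hTK : ∀ u ∈ K, ∀ n : ℕ, (T ^ n) u ∈ K) (hTL : ∀ u ∈ L, ∀ n : ℕ, (T ^ n) u ∈ L)
    {ρ₀ ρ₁ : ℝ} (hρ₀ : 0 ≤ ρ₀) (hρ : ρ₀ < ρ₁)
    (hup : ∃ C : ℝ, 0 ≤ C ∧ ∀ u ∈ L, ∀ n : ℕ, ‖(T ^ n) u‖ ≤ C * ρ₀ ^ n * ‖u‖)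
    (hlow : ∃ C : ℝ, 0 ≤ C ∧ ∀ u ∈ K, ∀ n : ℕ, ρ₁ ^ n * ‖u‖ ≤ C * ‖(T ^ n) u‖)
    (hsurj : ∀ u ∈ K, ∀ n : ℕ, ∃ v ∈ K, (T ^ n) v = u) :
    Tendsto (fun l : ℕ => gap (iterates T E₀ l) K) atTop (𝓝 0) := by
  obtain ⟨C₀, hC₀, hup⟩ := hup
  obtain ⟨C₁, hC₁, hlow⟩ := hlow
  have hρ₁ : 0 < ρ₁ := hρ₀.trans_lt hρ
  -- An injective linear map on a finite-dimensional space is bounded below.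
  obtain ⟨C₂, hC₂⟩ : ∃ C : ℝ≥0, ∀ u ∈ E₀, ‖u‖ ≤ C * ‖P u‖ := by
    obtain ⟨C, -, hC⟩ := LinearMap.exists_antilipschitzWith ((P : V →ₗ[ℂ] V) ∘ₗ E₀.subtype) (by
      rw [LinearMap.ker_eq_bot']
      rintro ⟨u, hu⟩ h
      exact Subtype.ext (hinj u hu h))
    refine ⟨C, fun u hu => ?_⟩
    have := hC.le_mul_dist ⟨u, hu⟩ 0
    rw [map_zero, dist_zero_right, dist_zero_right] at this
    exact this
  have hPmem : ∀ u ∈ E₀, P u ∈ K := fun u hu => hmap ▸ Submodule.mem_map_of_mem hu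
  set D : ℝ := C₀ * (1 + ‖P‖) * C₂ * C₁ with hD
  have hD0 : 0 ≤ D := by positivity
  -- The error Tˡ(u - Pu) lies in the slow space L and is measured against TˡPu in the fast space K,
  -- which gives the ratio ρ₀/ρ₁. Either vector can then be normalized, giving the two one-sided
  -- gaps.
  have key : ∀ u ∈ E₀, ∀ l : ℕ,
      ‖(T ^ l) u - (T ^ l) (P u)‖ ≤ D * (ρ₀ / ρ₁) ^ l * ‖(T ^ l) (P u)‖ := by
    intro u hu l
    rw [← map_sub]
    have h1 : ‖u - P u‖ ≤ (1 + ‖P‖) * ‖u‖ := by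
      have := norm_sub_le u (P u)
      have := P.le_opNorm u
      linarith
    have h2 : ‖P u‖ ≤ C₁ * ‖(T ^ l) (P u)‖ / ρ₁ ^ l := by
      rw [le_div_iff₀ (by positivity), mul_comm]
      exact hlow _ (hPmem u hu) l
    calc _ ≤ C₀ * ρ₀ ^ l * ‖u - P u‖ := hup _ (hL u) l
      _ ≤ C₀ * ρ₀ ^ l * ((1 + ‖P‖) * (C₂ * (C₁ * ‖(T ^ l) (P u)‖ / ρ₁ ^ l))) := by
        gcongr
        refine h1.trans ?_
        gcongr
        refine (hC₂ u hu).trans ?_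
        gcongr
      _ = _ := by rw [hD, div_pow]; ring
  have hlim : Tendsto (fun l : ℕ => D * (ρ₀ / ρ₁) ^ l * (1 + ‖P‖)) atTop (𝓝 0) := by
    have := (tendsto_pow_atTop_nhds_zero_of_lt_one (div_nonneg hρ₀ hρ₁.le)
      ((div_lt_one hρ₁).2 hρ))
    simpa using (this.const_mul D).mul_const (1 + ‖P‖)
  refine squeeze_zero (fun l => (oneSidedGap_nonneg _ _).trans (le_max_left _ _)) (fun l => ?_) hlim
  have hc : 0 ≤ D * (ρ₀ / ρ₁) ^ l := by positivity
  refine max_le ?_ ?_ 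
  · refine oneSidedGap_le (by positivity) fun v hv hv1 => ?_
    obtain ⟨u, hu, rfl⟩ := mem_iterates_iff.1 hv
    refine ⟨(T ^ l) (P u), hTK _ (hPmem u hu) l, (key u hu l).trans ?_⟩
    have hPv : P ((T ^ l) u) = (T ^ l) (P u) := by
      have h1 := hPL _ (hTL _ (hL u) l)
      rw [map_sub, map_sub, hPK _ (hTK _ (hPmem u hu) l), sub_eq_zero] at h1
      exact h1
    have := P.le_opNorm ((T ^ l) u)
    rw [hPv, hv1] at this
    gcongr
    linarith
  · refine oneSidedGap_le (by positivity) fun v hv hv1 => ?_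
    obtain ⟨a, ha, rfl⟩ := hsurj v hv l
    obtain ⟨u, hu, rfl⟩ := Submodule.mem_map.1 (hmap ▸ ha)
    refine ⟨(T ^ l) u, mem_iterates_iff.2 ⟨u, hu, rfl⟩, ?_⟩
    have := key u hu l
    rw [norm_sub_rev]
    refine this.trans ?_
    have h1 : ‖(T ^ l) (P u)‖ = 1 := hv1
    rw [h1]
    gcongr
    linarith [norm_nonneg P]

end GapConvergence

/-! ### Resolvents of unbounded operators -/

section ResolventsOfUnboundedOperators

variable {H : Type*} [NormedAddCommGroup H] [InnerProductSpace ℂ H] {A : H →ₗ.[ℂ] H}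

theorem IsResolventAt.apply_sub {z : ℂ} {R : H →L[ℂ] H} (h : IsResolventAt A z R) {u : H}
    (hu : u ∈ A.domain) : R (z • u - A ⟨u, hu⟩) = u := h.2 ⟨u, hu⟩

theorem IsResolventAt.sub_eq {z z' : ℂ} {R R' : H →L[ℂ] H} (h : IsResolventAt A z R)
    (h' : IsResolventAt A z' R') : R - R' = (z' - z) • (R * R') := by
  ext x
  obtain ⟨hx, hx'⟩ := h'.1 x
  have h1 := h.apply_sub hx
  have h2 : z • R' x - A ⟨R' x, hx⟩ = x - (z' - z) • R' x := by
    linear_combination (norm := module) hx'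
  rw [h2, map_sub, map_smul] at h1
  rw [sub_apply, smul_apply, mul_apply_eq_comp]
  linear_combination (norm := module) h1

theorem IsResolventAt.unique {z : ℂ} {R R' : H →L[ℂ] H} (h : IsResolventAt A z R)
    (h' : IsResolventAt A z R') : R = R' := by
  have := h.sub_eq h'
  rwa [sub_self, zero_smul, sub_eq_zero] at this

theorem IsResolventAt.commute {z z' : ℂ} {R R' : H →L[ℂ] H} (h : IsResolventAt A z R)
    (h' : IsResolventAt A z' R') : R * R' = R' * R := by
  by_cases hz : z = z'
  · subst hz
    rw [h.unique h']
  · have h1 := h.sub_eq h'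
    have h2 := h'.sub_eq h
    rw [← neg_sub, h1, ← neg_smul, neg_sub] at h2
    exact smul_right_injective _ (sub_ne_zero.2 hz) h2

theorem IsResolventAt.apply_of_mem_eigSpace {z lam : ℂ} {R : H →L[ℂ] H} (h : IsResolventAt A z R)
    {x : H} (hx : x ∈ eigSpace A lam) : (z - lam) • R x = x := by
  obtain ⟨hd, he⟩ := hx
  have := h.apply_sub hd
  rwa [he, ← sub_smul, map_smul] at this

theorem IsResolventAt.mem_eigSpace {z : ℂ} {ζ : ℂ} {R : H →L[ℂ] H} (h : IsResolventAt A z R)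
    (hζ : ζ ≠ 0) {x : H} (hx : R x = ζ • x) : x ∈ eigSpace A (z - ζ⁻¹) := by
  obtain ⟨hd, he⟩ := h.1 x
  have hx' : x = ζ⁻¹ • R x := by rw [hx, smul_smul, inv_mul_cancel₀ hζ, one_smul]
  have hd' : x ∈ A.domain := hx' ▸ A.domain.smul_mem _ hd
  refine ⟨hd', ?_⟩
  have e : (⟨x, hd'⟩ : A.domain) = ζ⁻¹ • ⟨R x, hd⟩ := Subtype.ext hx'
  have h1 : A ⟨R x, hd⟩ = z • R x - x := by
    linear_combination (norm := module) -he
  rw [e, LinearPMap.map_smul, h1, hx, smul_sub, smul_smul, smul_smul, sub_smul]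
  congr 2
  field_simp

theorem mem_opSpectrum_of_eigSpace_ne_bot {lam : ℂ} (h : eigSpace A lam ≠ ⊥) :
    lam ∈ opSpectrum A := by
  rintro ⟨R, hR⟩
  refine h ((Submodule.eq_bot_iff _).2 fun x hx => ?_)
  rw [← hR.apply_of_mem_eigSpace hx, sub_self, zero_smul]

/-- If R' were a resolvent at z - ζ⁻¹, the first resolvent identity would make ζ⁻¹(1 + ζ⁻¹R') an
inverse of ζ - R. -/
theorem IsResolventAt.mem_opSpectrum {z ζ : ℂ} {R : H →L[ℂ] H} (h : IsResolventAt A z R)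
    (hζ : ζ ∈ spectrum ℂ R) (hζ0 : ζ ≠ 0) : z - ζ⁻¹ ∈ opSpectrum A := by
  rintro ⟨R', hR'⟩
  refine hζ ?_
  have h1 := h.sub_eq hR'
  have h2 : z - ζ⁻¹ - z = -ζ⁻¹ := by ring
  have h3 := h.commute hR'
  rw [h2] at h1
  have h4 : R * R' = ζ • (R' - R) := by
    rw [← neg_sub R R', h1, neg_smul, neg_neg, smul_smul, mul_inv_cancel₀ hζ0, one_smul]
  refine spectrum.mem_resolventSet_of_left_right_inverse (b := ζ⁻¹ • (1 + ζ⁻¹ • R'))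
    (c := ζ⁻¹ • (1 + ζ⁻¹ • R')) ?_ ?_
  · have e : (algebraMap ℂ (H →L[ℂ] H) ζ - R) * (1 + ζ⁻¹ • R') =
        ζ • 1 + (ζ * ζ⁻¹) • R' - R - ζ⁻¹ • (R * R') := by
      simp only [Algebra.algebraMap_eq_smul_one, sub_mul, mul_add, smul_mul_assoc, one_mul,
        mul_one, mul_smul_comm]
      module
    rw [mul_smul_comm, e, h4, smul_smul ζ⁻¹ ζ, inv_mul_cancel₀ hζ0, mul_inv_cancel₀ hζ0, one_smul,
      one_smul, add_sub_assoc, add_sub_assoc, sub_self, add_zero, smul_smul, inv_mul_cancel₀ hζ0, one_smul]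
  · have e : (1 + ζ⁻¹ • R') * (algebraMap ℂ (H →L[ℂ] H) ζ - R) =
        ζ • 1 + (ζ * ζ⁻¹) • R' - R - ζ⁻¹ • (R' * R) := by
      simp only [Algebra.algebraMap_eq_smul_one, mul_sub, add_mul, one_mul, smul_mul_assoc,
        mul_smul_comm, mul_one]
      module
    rw [smul_mul_assoc, e, ← h3, h4, smul_smul ζ⁻¹ ζ, inv_mul_cancel₀ hζ0, mul_inv_cancel₀ hζ0,
      one_smul, one_smul, add_sub_assoc, add_sub_assoc, sub_self, add_zero, smul_smul, inv_mul_cancel₀ hζ0,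
      one_smul]

variable [CompleteSpace H]

/-- For selfadjoint A, R(z)* is the resolvent at the conjugate of z. As resolvents commute, R(z) is
normal, which opens the continuous functional calculus. -/
theorem IsResolventAt.adjoint (hA : IsSelfAdjoint A) {z : ℂ} {R : H →L[ℂ] H}
    (h : IsResolventAt A z R) :
    IsResolventAt A (starRingEnd ℂ z) (ContinuousLinearMap.adjoint R) := by
  have hdense := hA.dense_domain
  have hadj : A.adjoint = A := hA
  have hsym : A.IsFormalAdjoint A := by
    have := LinearPMap.adjoint_isFormalAdjoint hdense
    rwa [hadj] at this
  have key : ∀ x : H, ∀ v : A.domain,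
      inner ℂ (starRingEnd ℂ z • ContinuousLinearMap.adjoint R x - x) (v : H) =
        inner ℂ (ContinuousLinearMap.adjoint R x) (A v) := by
    intro x v
    have h1 : R (A v) = z • R v - v := by
      have := h.2 v
      rw [map_sub, map_smul] at this
      linear_combination (norm := module) -this
    rw [ContinuousLinearMap.adjoint_inner_left, h1, inner_sub_left, inner_sub_right,
      inner_smul_left, inner_smul_right, ContinuousLinearMap.adjoint_inner_left, Complex.conj_conj]
  refine ⟨fun x => ?_, fun u => ?_⟩
  · have hx : ContinuousLinearMap.adjoint R x ∈ A.adjoint.domain :=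
      LinearPMap.mem_adjoint_domain_of_exists _ ⟨_, key x⟩
    -- The domain depends on the operator, so the equality of A with its adjoint is used by
    -- substituting for a variable `B`.
    have htrans : ∀ B : H →ₗ.[ℂ] H, B = A → ∀ (v : H) (hv : v ∈ B.domain),
        ∃ hv' : v ∈ A.domain, A ⟨v, hv'⟩ = B ⟨v, hv⟩ := by
      rintro _ rfl v hv
      exact ⟨hv, rfl⟩
    obtain ⟨hx', h2⟩ := htrans _ hadj _ hx
    refine ⟨hx', ?_⟩
    have h1 : A.adjoint ⟨_, hx⟩ = starRingEnd ℂ z • ContinuousLinearMap.adjoint R x - x :=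
      LinearPMap.adjoint_apply_eq hdense ⟨_, hx⟩ (key x)
    rw [h2, h1]
    abel
  · refine ext_inner_right ℂ fun y => ?_
    obtain ⟨hy, hy'⟩ := h.1 y
    rw [ContinuousLinearMap.adjoint_inner_left, inner_sub_left, inner_smul_left,
      Complex.conj_conj]
    have h1 : inner ℂ (A u) (R y) = inner ℂ (u : H) (A ⟨R y, hy⟩) := hsym u ⟨R y, hy⟩
    nth_rewrite 3 [← hy']
    rw [h1, inner_sub_right, inner_smul_right]

theorem IsResolventAt.isStarNormal (hA : IsSelfAdjoint A) {z : ℂ} {R : H →L[ℂ] H}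
    (h : IsResolventAt A z R) : IsStarNormal R :=
  ⟨(h.adjoint hA).commute h⟩

end ResolventsOfUnboundedOperators

/-! ### Consequences of the contraction condition -/

section FilterFacts

variable {N : ℕ} {w : Fin (N + 1) → ℂ} {z : Fin N → ℂ}

theorem tendsto_rN_atTop (w : Fin (N + 1) → ℂ) (z : Fin N → ℂ) :
    Tendsto (fun x : ℝ => rN w z (x : ℂ)) atTop (𝓝 (w (Fin.last N))) := by
  have h : ∀ k : Fin N, Tendsto (fun x : ℝ => w k.castSucc * (z k - (x : ℂ))⁻¹) atTop (𝓝 0) := by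
    intro k
    have h1 : Tendsto (fun x : ℝ => z k - (x : ℂ)) atTop (Bornology.cobounded ℂ) := by
      have h2 : Tendsto (fun x : ℝ => (x : ℂ)) atTop (Bornology.cobounded ℂ) := by
        rw [← tendsto_norm_atTop_iff_cobounded]
        simpa using tendsto_abs_atTop_atTop
      rw [← tendsto_norm_atTop_iff_cobounded] at h2 ⊢
      refine tendsto_atTop_mono (fun x => ?_) (tendsto_atTop_add_const_right _ (-‖z k‖) h2)
      have := norm_sub_norm_le (x : ℂ) (z k)
      rw [norm_sub_rev] at this
      linarith
    simpa using (tendsto_inv₀_cobounded.comp h1).const_mul (w k.castSucc)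
  simpa [rN] using (tendsto_finsetSum Finset.univ fun k _ => h k).const_add (w (Fin.last N))

/-- The outer set is unbounded and `w_N` is the value of `r_N` at infinity. It is needed because 0,
the image of infinity, may lie in the spectrum of a resolvent. -/
theorem enorm_last_le_supAbs (y δ γ : ℝ) :
    ‖w (Fin.last N)‖ₑ ≤ supAbs w z (outerSet y δ γ) := by
  refine le_of_tendsto (tendsto_rN_atTop w z).enorm ?_
  have h1 : ∀ᶠ x : ℝ in atTop, ∀ k, z k ≠ (x : ℂ) := by
    rw [eventually_all]
    intro k
    filter_upwards [eventually_gt_atTop (z k).re] with x hx h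
    rw [h] at hx
    simp at hx
  filter_upwards [h1, eventually_ge_atTop (y + (1 + δ) * γ)] with x hx hx'
  refine le_iSup₂_of_le x ⟨?_, hx⟩ le_rfl
  rw [outerSet, mem_ofPred_eq]
  exact le_trans (by linarith) (le_abs_self _)

theorem supAbs_lt_infAbs {y δ γ : ℝ} (hγ : 0 < γ) (h0 : infAbs w z (innerInterval y γ) ≠ 0)
    (hκ : kappaHat w z y δ γ < 1) :
    supAbs w z (outerSet y δ γ) < infAbs w z (innerInterval y γ) := by
  have htop : infAbs w z (innerInterval y γ) ≠ ⊤ := by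
    have hinf : (Icc (y - γ) (y + γ) : Set ℝ).Infinite := Icc_infinite (by linarith)
    obtain ⟨x, hx, hx'⟩ := hinf.exists_notMem_finite
      ((Set.finite_range z).preimage Complex.ofReal_injective.injOn)
    refine ne_top_of_le_ne_top (enorm_ne_top (x := rN w z x)) (iInf₂_le x ⟨?_, fun k hk => ?_⟩)
    · rw [innerInterval, mem_ofPred_eq, abs_le]
      constructor <;> linarith [hx.1, hx.2]
    · exact hx' ⟨k, hk⟩
  rw [kappaHat, ENNReal.div_lt_iff (Or.inl h0) (Or.inl htop), one_mul] at hκ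
  exact hκ

end FilterFacts

/-! ### The filter on H and the spectral projection of the cluster -/

section FilterOnH

variable {H : Type*} [NormedAddCommGroup H] [InnerProductSpace ℂ H] {N : ℕ}

/-- The filter `r_N(A)` as a bounded operator on `H`. -/
noncomputable def filterOnH (A : H →ₗ.[ℂ] H) (w : Fin (N + 1) → ℂ) (z : Fin N → ℂ) : H →L[ℂ] H :=
  w (Fin.last N) • 1 + ∑ k : Fin N, w k.castSucc • opResolvent A (z k)

/-- The function `g` with `g(R(z₀)) = r_N(A)`. -/
noncomputable def filterSymbol (w : Fin (N + 1) → ℂ) (z : Fin N → ℂ) (z₀ ζ : ℂ) : ℂ :=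
  w (Fin.last N) + ∑ k : Fin N, w k.castSucc * (ζ * (1 + (z k - z₀) * ζ)⁻¹)

variable {A : H →ₗ.[ℂ] H} {w : Fin (N + 1) → ℂ} {z : Fin N → ℂ} {z₀ : ℂ}

theorem filterSymbol_zero : filterSymbol w z z₀ 0 = w (Fin.last N) := by simp [filterSymbol]

theorem filterSymbol_eq_rN {ζ : ℂ} (hζ : ζ ≠ 0) : filterSymbol w z z₀ ζ = rN w z (z₀ - ζ⁻¹) := by
  rw [filterSymbol, rN]
  congr 1
  refine Finset.sum_congr rfl fun k _ => ?_
  congr 1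
  have : 1 + (z k - z₀) * ζ = ζ * (z k - (z₀ - ζ⁻¹)) := by
    field_simp
    ring
  rw [this, mul_inv, ← mul_assoc, mul_inv_cancel₀ hζ, one_mul]

theorem one_add_mul_ne_zero_of_mem_spectrum {z₁ ζ : ℂ} {R : H →L[ℂ] H} (h₀ : IsResolventAt A z₀ R)
    (h₁ : z₁ ∈ opResolventSet A) (hζ : ζ ∈ spectrum ℂ R) : 1 + (z₁ - z₀) * ζ ≠ 0 := by
  rcases eq_or_ne ζ 0 with rfl | h0
  · simp
  · intro h
    refine h₀.mem_opSpectrum hζ h0 ?_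
    have : z₀ - ζ⁻¹ = z₁ := by
      field_simp
      linear_combination -h
    rwa [this]

/-- With d = z₁ - z₀, both sides X solve (1 + dR)X = R, and 1 + dR has the left inverse 1 - dR(z₁)
by the resolvent identity. -/
theorem cfc_eq_opResolvent [CompleteSpace H] {z₁ : ℂ} {R : H →L[ℂ] H} [IsStarNormal R] (h₀ : IsResolventAt A z₀ R)
    (h₁ : z₁ ∈ opResolventSet A) :
    cfc (fun ζ : ℂ => ζ * (1 + (z₁ - z₀) * ζ)⁻¹) R = opResolvent A z₁ := by
  set R₁ := opResolvent A z₁ with hR₁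
  have hR : IsResolventAt A z₁ R₁ := opResolvent_spec h₁
  have hne : ∀ ζ ∈ spectrum ℂ R, 1 + (z₁ - z₀) * ζ ≠ 0 := fun ζ hζ =>
    one_add_mul_ne_zero_of_mem_spectrum h₀ h₁ hζ
  have hcont : ContinuousOn (fun ζ : ℂ => ζ * (1 + (z₁ - z₀) * ζ)⁻¹) (spectrum ℂ R) :=
    continuousOn_id.mul (ContinuousOn.inv₀ (by fun_prop) hne)
  set F := cfc (fun ζ : ℂ => ζ * (1 + (z₁ - z₀) * ζ)⁻¹) R with hF
  have h1 : (1 + (z₁ - z₀) • R) * F = R := by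
    have e : cfc (fun ζ : ℂ => 1 + (z₁ - z₀) * ζ) R = 1 + (z₁ - z₀) • R := by
      rw [cfc_const_add (1 : ℂ) (fun ζ => (z₁ - z₀) * ζ) R, cfc_const_mul_id (z₁ - z₀) R, map_one]
    rw [← e, hF, ← cfc_mul (fun ζ : ℂ => 1 + (z₁ - z₀) * ζ) _ R (by fun_prop) hcont]
    conv_rhs => rw [← cfc_id ℂ R]
    refine cfc_congr fun ζ hζ => ?_
    have := hne ζ hζ
    simp only [id]
    field_simp
  have h2 : (1 - (z₁ - z₀) • R₁) * (1 + (z₁ - z₀) • R) = 1 := by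
    have h3 := h₀.sub_eq hR
    rw [h₀.commute hR] at h3
    rw [sub_mul, one_mul, mul_add, mul_one, smul_mul_assoc, mul_smul_comm, ← h3, smul_sub]
    abel
  have h4 : (1 - (z₁ - z₀) • R₁) * R = R₁ := by
    have h3 := h₀.sub_eq hR
    rw [h₀.commute hR] at h3
    rw [sub_mul, one_mul, smul_mul_assoc, ← h3, sub_sub_cancel]
  rw [← one_mul F, ← h2, mul_assoc, h1, h4]

theorem continuousOn_filterSymbol {R : H →L[ℂ] H} (h₀ : IsResolventAt A z₀ R)
    (hz : ∀ k, z k ∈ opResolventSet A) : ContinuousOn (filterSymbol w z z₀) (spectrum ℂ R) := by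
  unfold filterSymbol
  refine continuousOn_const.add (continuousOn_finsetSum _ fun k _ => continuousOn_const.mul
    (continuousOn_id.mul (ContinuousOn.inv₀ (by fun_prop) fun ζ hζ => ?_)))
  exact one_add_mul_ne_zero_of_mem_spectrum h₀ (hz k) hζ

theorem cfc_filterSymbol [CompleteSpace H] {R : H →L[ℂ] H} [IsStarNormal R] (h₀ : IsResolventAt A z₀ R)
    (hz : ∀ k, z k ∈ opResolventSet A) : cfc (filterSymbol w z z₀) R = filterOnH A w z := by
  have hc : ∀ k, ContinuousOn (fun ζ : ℂ => ζ * (1 + (z k - z₀) * ζ)⁻¹) (spectrum ℂ R) :=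
    fun k => continuousOn_id.mul (ContinuousOn.inv₀ (by fun_prop) fun ζ hζ =>
      one_add_mul_ne_zero_of_mem_spectrum h₀ (hz k) hζ)
  have hc' : ∀ k, ContinuousOn (fun ζ : ℂ => w k.castSucc * (ζ * (1 + (z k - z₀) * ζ)⁻¹))
      (spectrum ℂ R) := fun k => continuousOn_const.mul (hc k)
  have e : filterSymbol w z z₀ = fun ζ => w (Fin.last N) +
      (∑ k, fun ζ : ℂ => w k.castSucc * (ζ * (1 + (z k - z₀) * ζ)⁻¹)) ζ := by
    ext ζ
    rw [filterSymbol, Finset.sum_apply]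
  rw [e, cfc_const_add (w (Fin.last N)) _ R (by
    simpa [Finset.sum_fn] using continuousOn_finsetSum Finset.univ fun k _ => hc' k),
    cfc_sum_univ _ _ hc', filterOnH, Algebra.algebraMap_eq_smul_one]
  congr 1
  refine Finset.sum_congr rfl fun k _ => ?_
  rw [cfc_const_mul _ _ R (hc k), cfc_eq_opResolvent h₀ (hz k)]

/-- Values at isolated points do not affect continuity. Indicator functions of the cluster thereby
become admissible in the functional calculus. -/
theorem continuousOn_of_isolated {s : Set ℂ} {Z : Set ℂ} {f f' : ℂ → ℂ} (hZ : IsClosed Z)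
    (hiso : ∀ ζ ∈ Z, ∀ᶠ ξ in 𝓝[s] ζ, ξ = ζ) (hf' : ContinuousOn f' (s \ Z))
    (h : ∀ ζ ∉ Z, f ζ = f' ζ) : ContinuousOn f s := by
  intro ζ hζ
  by_cases hmem : ζ ∈ Z
  · refine tendsto_nhds_of_eventually_eq ?_
    filter_upwards [hiso ζ hmem] with ξ hξ
    rw [hξ]
  · have h1 : 𝓝[s \ Z] ζ = 𝓝[s] ζ :=
      nhdsWithin_inter_of_mem' (mem_nhdsWithin_of_mem_nhds (hZ.isOpen_compl.mem_nhds hmem))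
    have h2 : ContinuousWithinAt f' s ζ := by
      have := hf' ζ ⟨hζ, hmem⟩
      rwa [ContinuousWithinAt, h1] at this
    refine h2.congr_of_eventuallyEq ?_ (h ζ hmem)
    filter_upwards [mem_nhdsWithin_of_mem_nhds (hZ.isOpen_compl.mem_nhds hmem)] with ξ hξ
    exact h ξ hξ

/-- The spectral projection of `A` onto the cluster: a bounded operator with range `E` that commutes
with `r_N(A)` and separates `r_N(Λ)` from the rest of the spectrum of `r_N(A)`. -/
theorem exists_cluster_projection [CompleteSpace H] (hA : IsSelfAdjoint A) {Λ : Finset ℂ} (hΛ : Λ.Nonempty)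
    (hmult : ∀ lam ∈ Λ, eigSpace A lam ≠ ⊥) (hfilter : FilterAssumption A Λ w z) :
    ∃ p : H →L[ℂ] H, (∀ x, p x ∈ targetSpace A Λ) ∧ (∀ x ∈ targetSpace A Λ, p x = x) ∧
      p * filterOnH A w z = filterOnH A w z * p ∧
      ∀ μ ∈ rN w z '' (Λ : Set ℂ),
        μ ∈ resolventSet ℂ (filterOnH A w z - filterOnH A w z * p) := by
  classical
  obtain ⟨y, δ, γ, hδ, hγ, hΛI, hO, hnodes, h0, hκ⟩ := hfilter
  have hlt := supAbs_lt_infAbs hγ h0 hκ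
  have hlast := (enorm_last_le_supAbs (w := w) (z := z) y δ γ).trans_lt hlt
  have hspec : ∀ lam ∈ Λ, lam ∈ opSpectrum A := fun lam hl =>
    mem_opSpectrum_of_eigSpace_ne_bot (hmult lam hl)
  have hres : ∀ k, z k ∈ opResolventSet A := fun k => by
    by_contra h
    exact hnodes k (subset_closure h)
  have hne : ∀ k, ∀ x ∈ opSpectrum A, z k ≠ x := fun k x hx h => hx (h ▸ hres k)
  have hin : ∀ lam ∈ Λ, infAbs w z (innerInterval y γ) ≤ ‖rN w z lam‖ₑ := by
    intro lam hl
    obtain ⟨x, hx, rfl⟩ := hΛI hl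
    exact iInf₂_le x ⟨hx, fun k => hne k _ (hspec _ hl)⟩
  have hout : ∀ x ∈ opSpectrum A, x ∉ Λ → ‖rN w z x‖ₑ < infAbs w z (innerInterval y γ) := by
    intro x hx hxΛ
    obtain ⟨t, ht, rfl⟩ := hO ⟨hx, hxΛ⟩
    exact (le_iSup₂_of_le (f := fun (x : ℝ) _ => ‖rN w z (x : ℂ)‖ₑ) t ⟨ht, fun k => hne k _ hx⟩
      le_rfl).trans_lt hlt
  -- Without nodes `r_N` would be constant and κ̂ < 1 impossible; hence a node z₀ exists.
  have hN : 0 < N := by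
    rcases Nat.eq_zero_or_pos N with rfl | h
    · obtain ⟨lam, hl⟩ := hΛ
      have := hin lam hl
      simp only [rN, Finset.univ_eq_empty, Finset.sum_empty, add_zero] at this
      exact absurd hlast this.not_gt
    · exact h
  set z₀ := z ⟨0, hN⟩ with hz₀
  set R := opResolvent A z₀ with hR
  have h₀ : IsResolventAt A z₀ R := opResolvent_spec (hres _)
  have hnormal : IsStarNormal R := h₀.isStarNormal hA
  have hsub : ∀ lam ∈ Λ, z₀ - lam ≠ 0 := fun lam hl => sub_ne_zero.2 (hne _ _ (hspec lam hl))
  set Z : Finset ℂ := Λ.image fun lam => (z₀ - lam)⁻¹ with hZ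
  have hZmem : ∀ ζ, ζ ∈ Z ↔ ∃ lam ∈ Λ, (z₀ - lam)⁻¹ = ζ := fun ζ => Finset.mem_image
  have hZ0 : ∀ ζ ∈ Z, ζ ≠ 0 ∧ z₀ - ζ⁻¹ ∈ Λ := by
    intro ζ hζ
    obtain ⟨lam, hl, rfl⟩ := (hZmem ζ).1 hζ
    refine ⟨inv_ne_zero (hsub lam hl), ?_⟩
    rwa [inv_inv, sub_sub_cancel]
  have hmemZ : ∀ ζ, ζ ≠ 0 → z₀ - ζ⁻¹ ∈ Λ → ζ ∈ Z := by
    intro ζ _ hl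
    exact (hZmem ζ).2 ⟨_, hl, by rw [sub_sub_cancel, inv_inv]⟩
  have hZc : IsClosed (Z : Set ℂ) := Z.finite_toSet.isClosed
  -- Near ζ the point z₀ - ξ⁻¹ stays too close to y to lie in the outer set, so a spectral point ξ
  -- must belong to the finite set Z.
  have hiso : ∀ ζ ∈ (Z : Set ℂ), ∀ᶠ ξ in 𝓝[spectrum ℂ R] ζ, ξ = ζ := by
    intro ζ hζ
    obtain ⟨hζ0, hζΛ⟩ := hZ0 ζ hζ
    have hinv : ContinuousAt (fun ξ : ℂ => |(z₀ - ξ⁻¹).re - y|) ζ := by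
      have : ContinuousAt (fun ξ : ℂ => z₀ - ξ⁻¹) ζ :=
        continuousAt_const.sub (continuousAt_inv₀ hζ0)
      exact ((Complex.continuous_re.continuousAt.comp this).sub continuousAt_const).abs
    have h1 : ∀ᶠ ξ in 𝓝 ζ, |(z₀ - ξ⁻¹).re - y| < (1 + δ) * γ := by
      refine hinv.eventually_lt_const ?_
      obtain ⟨x, hx, hx'⟩ := hΛI hζΛ
      dsimp only
      rw [← hx', Complex.ofReal_re]
      have hx2 : |x - y| ≤ γ := hx
      nlinarith
    have h2 : ∀ᶠ ξ in 𝓝 ζ, ξ ∉ ((Z.erase ζ : Finset ℂ) : Set ℂ) :=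
      (Finset.finite_toSet _).isClosed.isOpen_compl.mem_nhds (by simp)
    filter_upwards [mem_nhdsWithin_of_mem_nhds h1, mem_nhdsWithin_of_mem_nhds h2,
      mem_nhdsWithin_of_mem_nhds (isOpen_ne.mem_nhds hζ0), self_mem_nhdsWithin] with ξ h1 h2 h3 h4
    by_contra hξ
    refine h2 (Finset.mem_coe.2 (Finset.mem_erase.2 ⟨hξ, hmemZ ξ h3 ?_⟩))
    by_contra hnot
    obtain ⟨x, hx, hx'⟩ := hO ⟨h₀.mem_opSpectrum h4 h3, hnot⟩
    rw [← hx', Complex.ofReal_re] at h1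
    exact absurd h1 (not_lt.2 hx)
  set g := filterSymbol w z z₀ with hg
  have hgc : ContinuousOn g (spectrum ℂ R) := continuousOn_filterSymbol h₀ hres
  have hgS : cfc g R = filterOnH A w z := cfc_filterSymbol h₀ hres
  have hgout : ∀ ζ ∈ spectrum ℂ R, ζ ∉ Z → ‖g ζ‖ₑ < infAbs w z (innerInterval y γ) := by
    intro ζ hζ hζZ
    rcases eq_or_ne ζ 0 with rfl | hζ0
    · rwa [hg, filterSymbol_zero]
    · rw [hg, filterSymbol_eq_rN hζ0]
      exact hout _ (h₀.mem_opSpectrum hζ hζ0) fun h => hζZ (hmemZ ζ hζ0 h)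
  set χ : ℂ → ℂ := fun ζ => if ζ ∈ Z then 1 else 0 with hχ
  have hcont : ∀ f : ℂ → ℂ, (∃ f' : ℂ → ℂ, ContinuousOn f' (spectrum ℂ R \ Z) ∧
      ∀ ζ ∉ (Z : Set ℂ), f ζ = f' ζ) → ContinuousOn f (spectrum ℂ R) :=
    fun f ⟨f', hf', h⟩ => continuousOn_of_isolated hZc hiso hf' h
  have hχc : ContinuousOn χ (spectrum ℂ R) :=
    hcont χ ⟨fun _ => 0, continuousOn_const, fun ζ hζ => if_neg hζ⟩
  have hSp : filterOnH A w z * cfc χ R = cfc (fun ζ => g ζ * χ ζ) R := by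
    rw [← hgS, cfc_mul g χ R hgc hχc]
  refine ⟨cfc χ R, fun x => ?_, fun x hx => ?_, ?_, ?_⟩
  · have hc1 : ∀ ξ ∈ Z, ContinuousOn (fun ζ => if ζ = ξ then (1 : ℂ) else 0) (spectrum ℂ R) := by
      intro ξ hξ
      refine hcont _ ⟨fun _ => 0, continuousOn_const, fun ζ hζ => if_neg ?_⟩
      rintro rfl
      exact hζ hξ
    have hsum : cfc χ R = ∑ ξ ∈ Z, cfc (fun ζ => if ζ = ξ then (1 : ℂ) else 0) R := by
      rw [← cfc_sum _ _ _ hc1]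
      refine cfc_congr fun ζ _ => ?_
      simp [hχ]
    rw [hsum, sum_apply]
    refine Submodule.sum_mem _ fun ξ hξ => ?_
    obtain ⟨hξ0, hξΛ⟩ := hZ0 ξ hξ
    refine Submodule.mem_iSup_of_mem (z₀ - ξ⁻¹) (Submodule.mem_iSup_of_mem hξΛ
      (h₀.mem_eigSpace hξ0 ?_))
    rw [← mul_apply_eq_comp, ← smul_apply]
    congr 1
    nth_rewrite 1 [← cfc_id ℂ R]
    rw [← cfc_mul _ _ R continuousOn_id (hc1 ξ hξ), ← cfc_const_mul ξ _ R (hc1 ξ hξ)]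
    refine cfc_congr fun ζ _ => ?_
    by_cases h : ζ = ξ <;> simp [h]
  · refine Submodule.iSup_induction (fun lam => ⨆ (_ : lam ∈ Λ), eigSpace A lam)
      (motive := fun x => cfc χ R x = x) hx (fun lam x hx => ?_) (map_zero _) (fun a b ha hb => ?_)
    · by_cases hl : lam ∈ Λ
      · simp only [hl, iSup_pos] at hx
        set ξ := (z₀ - lam)⁻¹ with hξ
        have hξZ : ξ ∈ Z := (hZmem ξ).2 ⟨lam, hl, rfl⟩
        have h1 : R x = ξ • x := by
          have := h₀.apply_of_mem_eigSpace hx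
          nth_rewrite 2 [← this]
          rw [hξ, smul_smul, inv_mul_cancel₀ (hsub lam hl), one_smul]
        -- This makes 1 - χ divisible by ζ - ξ, so 1 - χ(R) kills every x with Rx = ξx.
        set k : ℂ → ℂ := fun ζ => if ζ ∈ Z then 0 else (ζ - ξ)⁻¹ with hk
        have hkc : ContinuousOn k (spectrum ℂ R) := by
          refine hcont k ⟨fun ζ => (ζ - ξ)⁻¹, ContinuousOn.inv₀ (by fun_prop) ?_,
            fun ζ hζ => if_neg hζ⟩
          rintro ζ ⟨-, hζ⟩ h
          exact hζ (sub_eq_zero.1 h ▸ hξZ)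
        have h2 : cfc (fun ζ => 1 - χ ζ) R = 1 - cfc χ R := by
          rw [cfc_sub (fun _ => 1) χ R continuousOn_const hχc, cfc_const_one ℂ R]
        have h3 : cfc (fun ζ => 1 - χ ζ) R = cfc k R * (R - algebraMap ℂ _ ξ) := by
          have e : cfc (fun ζ => ζ - ξ) R = R - algebraMap ℂ _ ξ := by
            rw [cfc_sub (fun ζ => ζ) (fun _ => ξ) R continuousOn_id continuousOn_const,
              cfc_id' ℂ R, cfc_const ξ R]
          rw [← e, ← cfc_mul k _ R hkc (by fun_prop)]
          refine cfc_congr fun ζ _ => ?_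
          by_cases h : ζ ∈ Z
          · simp [hχ, hk, h]
          · have : ζ - ξ ≠ 0 := fun h' => h (sub_eq_zero.1 h' ▸ hξZ)
            simp [hχ, hk, h, this]
        have h4 := DFunLike.congr_fun (h2.symm.trans h3) x
        rw [mul_apply_eq_comp, sub_apply, sub_apply, Algebra.algebraMap_eq_smul_one, smul_apply,
          one_apply_eq_self, h1, sub_self, map_zero, sub_eq_zero] at h4
        exact h4.symm
      · simp only [hl, Submodule.mem_bot, iSup_neg, not_false_eq_true] at hx
        rw [hx, map_zero]
    · rw [map_add, ha, hb]
  · rw [hSp, ← hgS, ← cfc_mul χ g R hχc hgc]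
    simp only [mul_comm]
  · rintro _ ⟨lam, hl, rfl⟩
    have hμ0 : rN w z lam ≠ 0 := by
      intro h
      have := hin lam hl
      rw [h, enorm_zero] at this
      exact h0 (le_antisymm this zero_le)
    -- By spectral mapping the spectrum consists of values of g(1 - χ): this is 0 on Z and of
    -- modulus below inf |r_N| on I elsewhere, so it never equals μ.
    rw [hSp, ← hgS, ← cfc_sub g (fun ζ => g ζ * χ ζ) R hgc (hgc.mul hχc)]
    by_contra hmem
    have hmem' : rN w z lam ∈ spectrum ℂ (cfc (fun ζ => g ζ - g ζ * χ ζ) R) := hmem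
    rw [cfc_map_spectrum (fun ζ => g ζ - g ζ * χ ζ) R hnormal (hgc.sub (hgc.mul hχc))] at hmem'
    obtain ⟨ζ, hζ, he⟩ := hmem'
    by_cases hζZ : ζ ∈ Z
    · simp only [hχ, hζZ, if_true, mul_one, sub_self] at he
      exact hμ0 he.symm
    · simp only [hχ, hζZ, if_false, mul_zero, sub_zero] at he
      have h1 := hgout ζ hζ hζZ
      rw [he] at h1
      exact absurd h1 (hin lam hl).not_gt

end FilterOnH

/-! ### Spectral splitting and the contour projector -/

section SplitOperators

/-- T - TQ acts as T on the range of 1 - Q and as 0 on that of Q, so the inverse is assembled from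
R(z) and z⁻¹ on the two blocks. -/
theorem mem_resolventSet_sub_mul {B : Type*} [Ring B] [Algebra ℂ B] {T Q : B}
    (hQ : Q * Q = Q) (hTQ : T * Q = Q * T) {z : ℂ} (hz : z ∈ resolventSet ℂ T) (hz0 : z ≠ 0) :
    z ∈ resolventSet ℂ (T - T * Q) := by
  have h1 := sub_mul_resolvent hz
  have h2 := resolvent_mul_sub hz
  set R := resolvent T z
  have hc : (algebraMap ℂ B z - T) * Q = Q * (algebraMap ℂ B z - T) := by
    rw [sub_mul, mul_sub, hTQ, Algebra.commutes]
  have hRQ : R * Q = Q * R := by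
    calc R * Q = R * (Q * ((algebraMap ℂ B z - T) * R)) := by rw [h1, mul_one]
      _ = R * ((algebraMap ℂ B z - T) * Q) * R := by rw [hc]; simp only [mul_assoc]
      _ = Q * R := by rw [← mul_assoc R, h2, one_mul]
  have hP : (1 - Q) * (1 - Q) = 1 - Q := by
    rw [sub_mul, one_mul, mul_sub, mul_one, hQ, sub_self, sub_zero]
  have hQP : Q * (1 - Q) = 0 := by rw [mul_sub, mul_one, hQ, sub_self]
  have hPQ : (1 - Q) * Q = 0 := by rw [sub_mul, one_mul, hQ, sub_self]
  have e1 : algebraMap ℂ B z - (T - T * Q) = (algebraMap ℂ B z - T) * (1 - Q) + z • Q := by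
    rw [mul_sub, mul_one, sub_mul, Algebra.smul_def]
    abel
  have hcP : (algebraMap ℂ B z - T) * (1 - Q) = (1 - Q) * (algebraMap ℂ B z - T) := by
    rw [mul_sub, sub_mul 1 Q, hc, mul_one, one_mul]
  have hRP : R * (1 - Q) = (1 - Q) * R := by rw [mul_sub, sub_mul, hRQ, mul_one, one_mul]
  refine spectrum.mem_resolventSet_of_left_right_inverse (b := R * (1 - Q) + z⁻¹ • Q)
    (c := R * (1 - Q) + z⁻¹ • Q) ?_ ?_
  · have a1 : (algebraMap ℂ B z - T) * (1 - Q) * (R * (1 - Q)) = 1 - Q := by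
      rw [hRP, mul_assoc, ← mul_assoc (1 - Q), hP, ← hRP, ← mul_assoc, h1, one_mul]
    have a2 : (algebraMap ℂ B z - T) * (1 - Q) * Q = 0 := by rw [mul_assoc, hPQ, mul_zero]
    have a3 : Q * (R * (1 - Q)) = 0 := by rw [hRP, ← mul_assoc, hQP, zero_mul]
    rw [e1, add_mul, mul_add, mul_add, a1, mul_smul_comm, a2, smul_mul_assoc, a3, smul_mul_smul_comm,
      hQ, mul_inv_cancel₀ hz0]
    simp
  · have a1 : R * (1 - Q) * ((algebraMap ℂ B z - T) * (1 - Q)) = 1 - Q := by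
      rw [hcP, mul_assoc, ← mul_assoc (1 - Q), hP, ← hcP, ← mul_assoc, h2, one_mul]
    have a2 : R * (1 - Q) * Q = 0 := by rw [mul_assoc, hPQ, mul_zero]
    have a3 : Q * ((algebraMap ℂ B z - T) * (1 - Q)) = 0 := by rw [hcP, ← mul_assoc, hQP, zero_mul]
    rw [e1, mul_add, add_mul, add_mul, a1, mul_smul_comm, a2, smul_mul_assoc, a3, smul_mul_smul_comm,
      hQ, inv_mul_cancel₀ hz0]
    simp

variable {V : Type*} [NormedAddCommGroup V] [InnerProductSpace ℂ V]

theorem muStar_nonneg (T : V →L[ℂ] V) (M : Set ℂ) : 0 ≤ muStar T M :=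
  Real.sSup_nonneg (by rintro _ ⟨x, _, rfl⟩; exact norm_nonneg x)

/-- The winding number is 1 at μ but 0 throughout the disc. -/
theorem IsSeparatingContour.muStar_lt {T : V →L[ℂ] V} {M : Set ℂ} {θ : ℝ → ℂ}
    (hθ : IsSeparatingContour T M θ) {μ : ℂ} (hμ : μ ∈ M) : muStar T M < ‖μ‖ := by
  by_contra! h
  have h1 := hθ.excludes μ h
  rw [(hθ.encloses μ hμ).2] at h1
  exact one_ne_zero h1

/-- The radii used to separate the two parts of the spectrum. -/
theorem IsSeparatingContour.exists_radius {T : V →L[ℂ] V} {M : Set ℂ} {θ : ℝ → ℂ}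
    (hθ : IsSeparatingContour T M θ) (hM : M.Finite) :
    ∃ ε : ℝ, 0 < ε ∧ (∀ t ∈ Icc (0 : ℝ) 1, muStar T M + 3 * ε < ‖θ t‖) ∧
      ∀ μ ∈ M, muStar T M + 3 * ε < ‖μ‖ ∧ ∀ t ∈ Icc (0 : ℝ) 1, ε < ‖θ t - μ‖ := by
  obtain ⟨K, hK⟩ := hθ.curve.rectifiable
  obtain ⟨t₀, ht₀, hmin⟩ := isCompact_Icc.exists_isMinOn (nonempty_Icc.2 (zero_le_one' ℝ))
    (f := fun t => ‖θ t‖) hK.continuousOn.norm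
  have hev : ∀ c, muStar T M < c → ∀ᶠ ε : ℝ in 𝓝[>] 0, muStar T M + 3 * ε < c := by
    intro c hc
    refine mem_nhdsWithin_of_mem_nhds ?_
    have : ContinuousAt (fun ε : ℝ => muStar T M + 3 * ε) 0 := by fun_prop
    exact this.eventually_lt_const (by simpa using hc)
  have h2 : ∀ᶠ ε : ℝ in 𝓝[>] 0, ∀ μ ∈ M, muStar T M + 3 * ε < ‖μ‖ ∧
      ∀ t ∈ Icc (0 : ℝ) 1, ε < ‖θ t - μ‖ := by
    rw [eventually_all_finite hM]
    intro μ hμ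
    obtain ⟨d, hd, hdt⟩ := exists_pos_le_norm_sub hK.continuousOn (hθ.encloses μ hμ).1
    filter_upwards [hev _ (hθ.muStar_lt hμ), mem_nhdsWithin_of_mem_nhds (Iio_mem_nhds hd)] with ε h1 h2
    exact ⟨h1, fun t ht => lt_trans h2 (hdt t ht)⟩
  obtain ⟨ε, h1, h2, h3⟩ := ((hev _ (hθ.outside t₀ ht₀)).and (h2.and self_mem_nhdsWithin)).exists
  exact ⟨ε, h3, fun t ht => h1.trans_le (hmin ht), h2⟩

variable [CompleteSpace V]

theorem norm_le_muStar {T : V →L[ℂ] V} {M : Set ℂ} {z : ℂ} (hz : z ∈ spectrum ℂ T)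
    (hM : z ∉ M) : ‖z‖ ≤ muStar T M := by
  refine le_csSup ?_ ⟨z, ⟨hz, hM⟩, rfl⟩
  refine ⟨‖T‖ * ‖(1 : V →L[ℂ] V)‖, ?_⟩
  rintro _ ⟨x, hx, rfl⟩
  exact spectrum.norm_le_norm_mul_of_mem hx.1

theorem IsSeparatingContour.subset_resolventSet {T : V →L[ℂ] V} {M : Set ℂ} {θ : ℝ → ℂ}
    (hθ : IsSeparatingContour T M θ) : θ '' Icc 0 1 ⊆ resolventSet ℂ T := by
  rintro _ ⟨t, ht, rfl⟩
  by_contra h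
  exact ((hθ.outside t ht).trans_le (norm_le_muStar h fun hM =>
    (hθ.encloses _ hM).1 ⟨t, ht, rfl⟩)).false

/-- If `Q` splits off the eigenvalues in `M` on a larger space, then the remaining part `T (1 - Q)`
of `T` has its spectrum in the disc of radius `μ_*`. -/
theorem norm_le_muStar_of_mem_spectrum_sub_mul {H : Type*} [NormedAddCommGroup H]
    [InnerProductSpace ℂ H] [CompleteSpace H] {j : V →L[ℂ] H} (hj : Function.Injective j)
    {T Q : V →L[ℂ] V} {S p : H →L[ℂ] H} (hjT : ∀ u, j (T u) = S (j u))
    (hjQ : ∀ u, j (Q u) = p (j u)) (hQ : Q * Q = Q) (hTQ : T * Q = Q * T)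
    {M : Set ℂ} (hM : M.Finite)
    (hS : ∀ μ ∈ M, μ ∈ resolventSet ℂ (S - S * p)) {z : ℂ}
    (hz : z ∈ spectrum ℂ (T - T * Q)) : ‖z‖ ≤ muStar T M := by
  by_contra! h
  have key : ∀ ξ : ℂ, muStar T M < ‖ξ‖ → ξ ∉ M → ξ ∈ resolventSet ℂ (T - T * Q) := by
    intro ξ h1 h2
    refine mem_resolventSet_sub_mul hQ hTQ ?_ ?_
    · by_contra h3
      exact (h1.trans_le (norm_le_muStar h3 h2)).false
    · rw [← norm_pos_iff]
      exact (muStar_nonneg T M).trans_lt h1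
  refine hz ?_
  by_cases hzM : z ∈ M
  · refine mem_resolventSet_of_intertwining hj (S := S - S * p) (fun x => ?_) (hS z hzM) ?_
    · rw [sub_apply, sub_apply, mul_apply_eq_comp, mul_apply_eq_comp, map_sub, hjT, hjT, hjQ]
    · have h1 : ∀ᶠ ξ in 𝓝 z, muStar T M < ‖ξ‖ := continuous_norm.continuousAt.eventually_const_lt h
      have h2 : ∀ᶠ ξ in 𝓝 z, ξ ∉ M \ {z} :=
        (hM.subset sdiff_subset).isClosed.isOpen_compl.mem_nhds (by simp)
      rw [eventually_nhdsWithin_iff]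
      filter_upwards [h1, h2] with ξ h1 h2 h3
      exact key ξ h1 fun h4 => h2 ⟨h4, h3⟩
  · exact key z h hzM

/-- The spectral projector annihilates the kernel of `Q`. -/
theorem spectralProjector_apply_eq_zero {T Q : V →L[ℂ] V} {M : Set ℂ} {θ : ℝ → ℂ}
    (hθ : IsSeparatingContour T M θ) (hTQ : T * Q = Q * T)
    (hspec : ∀ z ∈ spectrum ℂ (T - T * Q), ‖z‖ ≤ muStar T M) {u : V} (hu : Q u = 0) :
    spectralProjector T θ u = 0 := by
  obtain ⟨K, hK⟩ := hθ.curve.rectifiable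
  obtain ⟨t₀, ht₀, hmin⟩ := isCompact_Icc.exists_isMinOn (nonempty_Icc.2 (zero_le_one' ℝ))
    (f := fun t => ‖θ t‖) hK.continuousOn.norm
  obtain ⟨ρ, hρ, hρ'⟩ := exists_between (hθ.outside t₀ ht₀)
  have hρ0 : 0 < ρ := (muStar_nonneg T M).trans_lt hρ
  obtain ⟨C, -, hC⟩ := exists_norm_pow_le (T - T * Q) hρ0 fun z hz => (hspec z hz).trans_lt hρ
  -- On the T-invariant kernel of Q the powers of T are those of T - TQ, so they grow at a rate ρ
  -- below the distance from 0 to the curve, about which the winding number is 0.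
  have hpow : ∀ n : ℕ, (T ^ n) u = ((T - T * Q) ^ n) u ∧ Q ((T ^ n) u) = 0 := by
    intro n
    induction n with
    | zero => exact ⟨rfl, hu⟩
    | succ n ih =>
      refine ⟨?_, ?_⟩
      · rw [pow_succ', pow_succ', mul_apply_eq_comp, mul_apply_eq_comp, ← ih.1, sub_apply,
          mul_apply_eq_comp, ih.2, map_zero, sub_zero]
      · rw [pow_succ', ← mul_apply_eq_comp, ← mul_assoc, ← hTQ, mul_assoc, mul_apply_eq_comp,
          mul_apply_eq_comp, ih.2, map_zero]
  have h0 : windingNumber θ 0 = 0 := hθ.excludes 0 (by simpa using muStar_nonneg T M)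
  rw [spectralProjector_apply_eq_windingNumber_smul hK hθ.curve.closed hθ.subset_resolventSet
    (a := 0) (C := C * ‖u‖) hρ0.le hρ' (fun t ht => by simpa using hmin ht), h0, zero_smul]
  intro n
  rw [map_zero, sub_zero, (hpow n).1]
  calc _ ≤ ‖(T - T * Q) ^ n‖ * ‖u‖ := ContinuousLinearMap.le_opNorm _ _
    _ ≤ C * ρ ^ n * ‖u‖ := by gcongr; exact hC n
    _ = _ := by ring

/-- Subspace iteration for an algebraic operator `B` whose spectrum splits into a dominant part near
`M` and a part in a disc that is not enclosed by the contour. -/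
theorem tendsto_gap_iterates_range_spectralProjector {B : V →L[ℂ] V} (hB : IsIntegral ℂ B)
    {K : ℝ≥0} {θ : ℝ → ℂ} (hθ : LipschitzOnWith K θ (Icc 0 1)) (hclosed : θ 0 = θ 1)
    (hres : θ '' Icc 0 1 ⊆ resolventSet ℂ B) {M : Set ℂ} {r ε : ℝ} (hr : 0 ≤ r) (hε : 0 < ε)
    (hθr : ∀ t ∈ Icc (0 : ℝ) 1, r + 3 * ε < ‖θ t‖)
    (hM : ∀ μ ∈ M, r + 3 * ε < ‖μ‖ ∧ ∀ t ∈ Icc (0 : ℝ) 1, ε < ‖θ t - μ‖)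
    (hw0 : windingNumber θ 0 = 0) (hw1 : ∀ μ ∈ M, windingNumber θ μ = 1)
    (hspec : spectrum ℂ B ⊆ Metric.ball 0 (r + ε) ∪ ⋃ μ ∈ M, Metric.ball μ ε) :
    (∀ u, spectralProjector B θ (spectralProjector B θ u) = spectralProjector B θ u) ∧
      ∀ E₀ : Submodule ℂ V, FiniteDimensional ℂ E₀ →
        E₀.map (spectralProjector B θ : V →ₗ[ℂ] V) =
          LinearMap.range (spectralProjector B θ : V →ₗ[ℂ] V) →
        (∀ u ∈ E₀, spectralProjector B θ u = 0 → u = 0) →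
        Tendsto (fun l : ℕ => gap (iterates B E₀ l)
          (LinearMap.range (spectralProjector B θ : V →ₗ[ℂ] V))) atTop (𝓝 0) := by
  obtain ⟨f, g, hf, hg, hcop, hfg, hfroot, hgroot⟩ :=
    exists_isCoprime_aeval_mul_eq_zero hB fun z => ‖z‖ < r + ε
  have hgroot' : ∀ z, g.IsRoot z → ∃ μ ∈ M, ‖z - μ‖ < ε := by
    intro z hz
    obtain ⟨h1, h2⟩ := hgroot z hz
    rcases hspec h1 with h3 | h3
    · exact absurd (by simpa using h3) h2
    · simpa [dist_eq_norm] using h3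
  set P := spectralProjector B θ with hP
  have hfup := exists_norm_sub_pow_apply_le B f 0 (ρ := r + ε) (by linarith)
    fun z hz => by simpa using (hfroot z hz).2
  simp only [map_zero, sub_zero] at hfup
  have hPf : ∀ u ∈ kerAeval B f, P u = 0 := by
    intro u hu
    obtain ⟨C, -, hC⟩ := hfup
    rw [hP, spectralProjector_apply_eq_windingNumber_smul hθ hclosed hres (a := 0)
      (ρ := r + ε) (d := r + 3 * ε) (C := C * ‖u‖) (by linarith) (by linarith)
      (fun t ht => by simpa using (hθr t ht).le), hw0, zero_smul]
    intro n
    rw [map_zero, sub_zero]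
    exact (hC u hu n).trans_eq (by ring)
  have hPg : ∀ u ∈ kerAeval B g, P u = u := by
    have hle : kerAeval B g ≤ LinearMap.ker ((P - 1 : V →L[ℂ] V) : V →ₗ[ℂ] V) := by
      refine kerAeval_le_of_forall_isRoot hg fun z hz n u hu => ?_
      obtain ⟨μ, hμ, hzμ⟩ := hgroot' z hz
      obtain ⟨C, -, hC⟩ := exists_norm_sub_pow_apply_le B ((Polynomial.X - Polynomial.C z) ^ n) μ
        -- The expansion is centred at μ, where the winding number is known, rather than at the
        -- nearby eigenvalue z. The midpoint lies strictly between ‖z - μ‖ and ε, which bounds from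
        -- below the distance to the curve.
        (ρ := (‖z - μ‖ + ε) / 2) (by positivity) fun x hx => by
          have hx' := Polynomial.eval_pow (p := Polynomial.X - Polynomial.C z) n ▸ hx.eq_zero
          have hx0 : x = z := by
            rw [Polynomial.eval_sub, Polynomial.eval_X, Polynomial.eval_C] at hx'
            exact sub_eq_zero.1 (eq_zero_of_pow_eq_zero hx')
          rw [hx0]
          linarith
      have h1 : P u = windingNumber θ μ • u :=
        spectralProjector_apply_eq_windingNumber_smul hθ hclosed hres (a := μ)
          (ρ := (‖z - μ‖ + ε) / 2) (d := ε) (C := C * ‖u‖) (by positivity) (by linarith)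
          (fun t ht => ((hM μ hμ).2 t ht).le) fun n => (hC u hu n).trans_eq (by ring)
      rw [LinearMap.mem_ker]
      change P u - u = 0
      rw [h1, hw1 μ hμ, one_smul, sub_self]
    exact fun u hu => sub_eq_zero.1 (LinearMap.mem_ker.1 (hle hu))
  have hdec : ∀ u, P u ∈ kerAeval B g ∧ u - P u ∈ kerAeval B f := by
    intro u
    obtain ⟨v, hv, w, hw, rfl⟩ := exists_add_of_isCoprime (T := B) hcop (u := u) (by
      rw [mem_kerAeval, hfg]; rfl)
    rw [map_add, hPf v hv, hPg w hw, zero_add, add_sub_cancel_right]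
    exact ⟨hw, hv⟩
  have hrange : LinearMap.range (P : V →ₗ[ℂ] V) = kerAeval B g := by
    refine le_antisymm ?_ fun u hu => ⟨u, hPg u hu⟩
    rintro _ ⟨u, rfl⟩
    exact (hdec u).1
  refine ⟨fun u => hPg _ (hdec u).1, fun E₀ _ hmap hinj => ?_⟩
  -- Roots of g are within ε of points of modulus above r + 3ε, hence have modulus above r + 2ε;
  -- roots of f stay below r + ε.
  obtain ⟨hlow, hsurj⟩ := exists_le_norm_pow_apply B g (ρ := r + 2 * ε) (by linarith) fun z hz => by
    obtain ⟨μ, hμ, hzμ⟩ := hgroot' z hz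
    have h1 := norm_sub_norm_le μ z
    rw [norm_sub_rev] at h1
    linarith [(hM μ hμ).1]
  rw [hrange] at hmap ⊢
  exact tendsto_gap_iterates hmap hinj (fun u => (hdec u).2) hPg hPf
    (fun u hu n => pow_apply_mem_kerAeval n hu) (fun u hu n => pow_apply_mem_kerAeval n hu)
    (ρ₀ := r + ε) (ρ₁ := r + 2 * ε) (by linarith) (by linarith) hfup hlow hsurj

end SplitOperators

/-! ### Passage between H, V and the discretization -/

section Transfer

variable {H V : Type*} [NormedAddCommGroup H] [InnerProductSpace ℂ H]
  [NormedAddCommGroup V] [InnerProductSpace ℂ V]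

theorem finiteDimensional_targetSpace {A : H →ₗ.[ℂ] H} {Λ : Finset ℂ}
    (h : ∀ lam ∈ Λ, FiniteDimensional ℂ (eigSpace A lam)) :
    FiniteDimensional ℂ (targetSpace A Λ) := by
  have : ∀ lam : Λ, FiniteDimensional ℂ (eigSpace A (lam : ℂ)) := fun lam => h lam lam.2
  rw [targetSpace, iSup_subtype']
  infer_instance

/-- An operator on `H` with values in a finite-dimensional subspace of the range of `j` restricts
to a bounded operator on `V`. -/
theorem exists_intertwining_of_finiteDimensional {j : V →L[ℂ] H} {E : Submodule ℂ H}
    [FiniteDimensional ℂ E] (hE : E ≤ LinearMap.range (j : V →ₗ[ℂ] H)) {p : H →L[ℂ] H}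
    (hp : ∀ x, p x ∈ E) : ∃ Q : V →L[ℂ] V, ∀ u, j (Q u) = p (j u) := by
  -- A linear section of `j` is automatically continuous on the finite-dimensional E, so Q is p
  -- after `j`, followed by the section.
  obtain ⟨s, hs⟩ := ((j : V →ₗ[ℂ] H).rangeRestrict).exists_rightInverse_of_surjective
    (j : V →ₗ[ℂ] H).range_rangeRestrict
  refine ⟨(LinearMap.toContinuousLinearMap (s ∘ₗ Submodule.inclusion hE)).comp
    ((p.codRestrict E hp).comp j), fun u => ?_⟩
  have := LinearMap.congr_fun hs (Submodule.inclusion hE (p.codRestrict E hp (j u)))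
  exact congrArg Subtype.val this

variable {N : ℕ}

theorem apply_filterOp {A : H →ₗ.[ℂ] H} {ι : V →ₗ[ℂ] H} {w : Fin (N + 1) → ℂ} {z : Fin N → ℂ}
    (hb : ∀ k, BoundedIn ι (opResolvent A (z k) : H →ₗ[ℂ] H)) (u : V) :
    ι (filterOp A ι w z u) = filterOnH A w z (ι u) := by
  simp only [filterOp, filterOnH, add_apply, smul_apply, sum_apply, map_add, map_smul, map_sum,
    onV_spec (hb _), ContinuousLinearMap.id_apply, one_apply_eq_self]
  rfl

theorem discreteFilterOp_sub_mem {ι : V →ₗ[ℂ] H} (hι : Function.Injective ι)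
    {w : Fin (N + 1) → ℂ} {z : Fin N → ℂ} {Vh : Submodule ℂ V} {Rh : ℂ → H →ₗ[ℂ] Vh}
    (hb : ∀ k, BoundedIn ι (extendToH ι Vh (Rh (z k)))) (u : V) :
    discreteFilterOp ι w z Vh Rh u - w (Fin.last N) • u ∈ Vh := by
  have h : ∀ k, onV ι (extendToH ι Vh (Rh (z k))) u ∈ Vh := by
    intro k
    have : onV ι (extendToH ι Vh (Rh (z k))) u = Rh (z k) (ι u) := hι (onV_spec (hb k) u)
    rw [this]
    exact (Rh (z k) (ι u)).2
  simp only [discreteFilterOp, add_apply, smul_apply, sum_apply, ContinuousLinearMap.id_apply,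
    add_sub_cancel_left]
  exact Submodule.sum_mem _ fun k _ => Submodule.smul_mem _ _ (h k)

theorem tendsto_discreteFilterOp {A : H →ₗ.[ℂ] H} {ι : V →ₗ[ℂ] H} {w : Fin (N + 1) → ℂ}
    {z : Fin N → ℂ} {hs : Set ℝ} {Vh : ℝ → Submodule ℂ V} {Rh : (h : ℝ) → ℂ → H →ₗ[ℂ] Vh h}
    (hRh : ResolventLimitAssumption A ι z hs Vh Rh) :
    Tendsto (fun h => discreteFilterOp ι w z (Vh h) (Rh h)) (𝓝[hs] 0) (𝓝 (filterOp A ι w z)) :=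
  tendsto_const_nhds.add (tendsto_finsetSum _ fun k _ =>
    (tendsto_iff_norm_sub_tendsto_zero.2 (hRh.tendsto k)).const_smul _)

end Transfer

end FilteredSubspace

/-! ### The main theorem -/

theorem mainTheorem5
    {H V : Type*} [NormedAddCommGroup H] [InnerProductSpace ℂ H] [CompleteSpace H]
    [NormedAddCommGroup V] [InnerProductSpace ℂ V] [CompleteSpace V]
    (A : H →ₗ.[ℂ] H) (hA : IsSelfAdjoint A)
    (Λ : Finset ℂ) (hΛ : Λ.Nonempty)
    (hmult : ∀ lam ∈ Λ, FilteredSubspace.eigSpace A lam ≠ ⊥ ∧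
      FiniteDimensional ℂ (FilteredSubspace.eigSpace A lam))
    {N : ℕ} (w : Fin (N + 1) → ℂ) (z : Fin N → ℂ)
    (hfilter : FilteredSubspace.FilterAssumption A Λ w z)
    (ι : V →ₗ[ℂ] H) (hV : FilteredSubspace.SubspaceAssumption A Λ ι)
    (hs : Set ℝ) (hs_pos : hs ⊆ Ioi 0)
    (Vh : ℝ → Submodule ℂ V) (hVh : ∀ h ∈ hs, FiniteDimensional ℂ (Vh h))
    (Rh : (h : ℝ) → ℂ → H →ₗ[ℂ] Vh h)
    (hRh : FilteredSubspace.ResolventLimitAssumption A ι z hs Vh Rh)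
    (θ : ℝ → ℂ)
    (hθ : FilteredSubspace.IsSeparatingContour (FilteredSubspace.filterOp A ι w z)
      (FilteredSubspace.rN w z '' (Λ : Set ℂ)) θ) :
    ∃ h₀ : ℝ, 0 < h₀ ∧ ∀ h ∈ hs, h < h₀ →
      θ '' Icc 0 1 ⊆ resolventSet ℂ (FilteredSubspace.discreteFilterOp ι w z (Vh h) (Rh h)) ∧
      ∀ E₀ : Submodule ℂ V, E₀ ≤ Vh h →
        Module.finrank ℂ E₀ = Module.finrank ℂ (FilteredSubspace.targetSpace A Λ) →
        Module.finrank ℂ (E₀.map (FilteredSubspace.spectralProjector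
            (FilteredSubspace.discreteFilterOp ι w z (Vh h) (Rh h)) θ : V →ₗ[ℂ] V)) =
          Module.finrank ℂ (FilteredSubspace.targetSpace A Λ) →
        Tendsto (fun l : ℕ => FilteredSubspace.gap
            (FilteredSubspace.iterates
              (FilteredSubspace.discreteFilterOp ι w z (Vh h) (Rh h)) E₀ l)
            (LinearMap.range (FilteredSubspace.spectralProjector
              (FilteredSubspace.discreteFilterOp ι w z (Vh h) (Rh h)) θ : V →ₗ[ℂ] V)))
          atTop (𝓝 0) := by
  open FilteredSubspace in
  have hE : FiniteDimensional ℂ (targetSpace A Λ) :=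
    finiteDimensional_targetSpace fun lam hl => (hmult lam hl).2
  obtain ⟨p, hpE, hpid, hpS, hpM⟩ := exists_cluster_projection hA hΛ
    (fun lam hl => (hmult lam hl).1) hfilter
  obtain ⟨C, -, hC⟩ := hV.bound
  set j : V →L[ℂ] H := ι.mkContinuous C hC
  have hj : Function.Injective j := hV.injective
  set T := filterOp A ι w z
  set S := filterOnH A w z
  set M := rN w z '' (Λ : Set ℂ)
  have hM : M.Finite := Λ.finite_toSet.image _
  have hjT : ∀ u, j (T u) = S (j u) := apply_filterOp hRh.bounded
  obtain ⟨Q, hjQ⟩ : ∃ Q : V →L[ℂ] V, ∀ u, j (Q u) = p (j u) :=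
    exists_intertwining_of_finiteDimensional hV.contains hpE
  have hQ : Q * Q = Q := by
    ext u
    refine hj ?_
    rw [mul_apply_eq_comp, hjQ, hjQ, hpid _ (hpE _)]
  have hTQ : T * Q = Q * T := by
    ext u
    refine hj ?_
    rw [mul_apply_eq_comp, mul_apply_eq_comp, hjT, hjQ, hjQ, hjT]
    exact (DFunLike.congr_fun hpS (j u)).symm
  have hspecT : ∀ ξ ∈ spectrum ℂ (T - T * Q), ‖ξ‖ ≤ muStar T M := fun ξ hξ =>
    norm_le_muStar_of_mem_spectrum_sub_mul hj hjT hjQ hQ hTQ hM hpM hξ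
  have hPQ : ∀ u, Q u = 0 → spectralProjector T θ u = 0 := fun u hu =>
    spectralProjector_apply_eq_zero hθ hTQ hspecT hu
  obtain ⟨K, hK⟩ := hθ.curve.rectifiable
  obtain ⟨ε, hε, hεθ, hεM⟩ := hθ.exists_radius hM
  set U := Metric.ball (0 : ℂ) (muStar T M + ε) ∪ ⋃ μ ∈ M, Metric.ball μ ε with hU
  have hUo : IsOpen U := Metric.isOpen_ball.union (isOpen_biUnion fun _ _ => Metric.isOpen_ball)
  have hTU : spectrum ℂ T ⊆ U := by
    intro ξ hξ
    by_cases h : ξ ∈ M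
    · exact Or.inr (mem_iUnion₂.2 ⟨ξ, h, Metric.mem_ball_self hε⟩)
    · refine Or.inl ?_
      rw [mem_ball_zero_iff]
      linarith [norm_le_muStar hξ h]
  have hθU : ∀ B : V →L[ℂ] V, spectrum ℂ B ⊆ U → θ '' Icc 0 1 ⊆ resolventSet ℂ B := by
    rintro B hB _ ⟨t, ht, rfl⟩
    by_contra hmem
    rcases hB hmem with h | h
    · rw [mem_ball_zero_iff] at h
      linarith [hεθ t ht]
    · obtain ⟨μ, hμ, h⟩ := mem_iUnion₂.1 h
      rw [Metric.mem_ball, dist_eq_norm] at h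
      exact lt_asymm h ((hεM μ hμ).2 t ht)
  obtain ⟨η, hη, hηP⟩ := exists_norm_spectralProjector_sub_le hK hθ.subset_resolventSet
    (show (0 : ℝ) < 1 / 2 by norm_num)
  have hlim := tendsto_discreteFilterOp (w := w) hRh
  have hev : ∀ᶠ h in 𝓝[hs] (0 : ℝ), spectrum ℂ (discreteFilterOp ι w z (Vh h) (Rh h)) ⊆ U ∧
      ‖discreteFilterOp ι w z (Vh h) (Rh h) - T‖ < η := by
    -- Upper semicontinuity of the spectrum under norm convergence to T.
    refine (hlim.eventually (((upperHemicontinuous_iff.1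
      (upperHemicontinuous_spectrum ℂ (V →L[ℂ] V)) T).forall_isOpen) U hUo hTU)).and ?_
    filter_upwards [hlim.eventually (Metric.ball_mem_nhds T hη)] with h hh
    rwa [← dist_eq_norm]
  obtain ⟨h₀, hh₀, hsub⟩ := Metric.mem_nhdsWithin_iff.1 hev
  refine ⟨h₀, hh₀, fun h hhs hlt => ?_⟩
  obtain ⟨hspec, hclose⟩ := hsub ⟨by
    rw [mem_ball_zero_iff, Real.norm_eq_abs, abs_of_pos (hs_pos hhs)]
    exact hlt, hhs⟩
  set B := discreteFilterOp ι w z (Vh h) (Rh h)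
  have hres := hθU B hspec
  have := hVh h hhs
  have hBint : IsIntegral ℂ B := isIntegral_of_sub_mem_finiteDimensional
    (discreteFilterOp_sub_mem hV.injective (hRh.bounded_discrete h hhs))
  have hw0 : windingNumber θ 0 = 0 := hθ.excludes 0 (by simpa using muStar_nonneg T M)
  obtain ⟨hidem, hconv⟩ := tendsto_gap_iterates_range_spectralProjector hBint hK hθ.curve.closed
    hres (muStar_nonneg T M) hε hεθ hεM hw0 (fun μ hμ => (hθ.encloses μ hμ).2) hspec
  refine ⟨hres, fun E₀ hE₀ hdim hdimP => ?_⟩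
  set P := spectralProjector B θ
  have hclose' := hηP B hres hclose
  -- A vector of `E_h` killed by Q is also killed by the projector of T, hence fixed by a difference
  -- of norm at most 1/2.
  have hinjR : ∀ u ∈ LinearMap.range (P : V →ₗ[ℂ] V), Q u = 0 → u = 0 := by
    rintro _ ⟨v, rfl⟩ hu
    change Q (P v) = 0 at hu
    change P v = 0
    have h1 : (P - spectralProjector T θ) (P v) = P v := by
      rw [sub_apply, hidem, hPQ _ hu, sub_zero]
    have h2 := (P - spectralProjector T θ).le_opNorm (P v)
    rw [h1] at h2
    rw [← norm_le_zero_iff]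
    nlinarith [norm_nonneg (P v)]
  set φ : LinearMap.range (P : V →ₗ[ℂ] V) →ₗ[ℂ] targetSpace A Λ :=
    ((p.comp j : V →ₗ[ℂ] H).codRestrict _ fun u => hpE (j u)) ∘ₗ Submodule.subtype _
  have hφ : Function.Injective φ := by
    rw [← LinearMap.ker_eq_bot, LinearMap.ker_eq_bot']
    rintro ⟨u, hu⟩ h0
    refine Subtype.ext (hinjR u hu (hj ?_))
    rw [hjQ, map_zero]
    exact congrArg Subtype.val h0
  have hfd : FiniteDimensional ℂ (LinearMap.range (P : V →ₗ[ℂ] V)) :=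
    FiniteDimensional.of_injective φ hφ
  have hfin : Module.finrank ℂ (LinearMap.range (P : V →ₗ[ℂ] V)) ≤
      Module.finrank ℂ (targetSpace A Λ) := LinearMap.finrank_le_finrank_of_injective hφ
  have hfdE : FiniteDimensional ℂ E₀ := Submodule.finiteDimensional_of_le hE₀
  refine hconv E₀ hfdE ?_ ?_
  -- The image of `E₀` has dimension m inside `E_h`, whose dimension is at most m; injectivity on
  -- `E₀` follows next by rank-nullity.
  · exact Submodule.eq_of_le_of_finrank_le (LinearMap.map_le_range) (hfin.trans_eq hdimP.symm)
  · have h1 := LinearMap.finrank_range_add_finrank_ker ((P : V →ₗ[ℂ] V).domRestrict E₀)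
    rw [LinearMap.range_domRestrict, hdim, hdimP, Nat.add_eq_left, Submodule.finrank_eq_zero] at h1
    intro u hu hPu
    have h2 : (⟨u, hu⟩ : E₀) ∈ LinearMap.ker ((P : V →ₗ[ℂ] V).domRestrict E₀) := hPu
    rw [h1, Submodule.mem_bot] at h2
    exact congrArg Subtype.val h2
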